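/- Let $(X,d)$ be a finite metric space with $n=|X|$ points, let $k,z$ be positive integers with $z<n$, put $\gamma=z/n$, and let $\varepsilon>0$ and $\eta\in(0,1)$. For a nonempty set $A\subseteq X$ of centers let $$\phi_\varepsilon(X,A)=\min\Big\{\max_{p\in X'}\min_{c\in A}d(p,c)\ :\ X'\subseteq X,\ |X'|\ge n-(1+\varepsilon)z\Big\}$$ (a maximum over the empty set is $0$), and let $r_{opt}$ be the minimum of $\max_{p\in X'}\min_{c\in A}d(p,c)$ over all $X'\subseteq X$ with $|X'|\ge n-z$ and all $A\subseteq X$ with at most $k$ points, i.e. the optimal cost of $k$-center clustering with $z$ outliers. Consider the following greedy sampling algorithm with parameter $t$. Start (round $j=1$) by drawing $\big\lceil\frac{1}{1-\gamma}\log\frac1\eta\big\rceil$ points independently and uniformly from $X$; let $E$ be the set of these points. In each round $j=2,\dots,t$ let $Q_j$ be a set of $\min\{n,\lceil(1+\varepsilon)z\rceil\}$ points of $X$ farthest from the current $E$ (ties are broken arbitrarily, possibly depending on all choices made so far), draw $\big\lceil\frac{1+\varepsilon}{\varepsilon}\log\frac1\eta\big\rceil$ points independently and uniformly from $Q_j$,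 and add them to $E$. The output is $E$. Run the algorithm with $t=\Big\lceil\frac{k+\sqrt k}{1-\eta}\Big\rceil$. Then: 1. With probability at least $(1-\eta)\big(1-e^{-(1-\eta)/4}\big)$, $\ \phi_\varepsilon(X,E)\le 2\,r_{opt}$. 2. For every $B$ there is a constant $C>0$, depending only on $\eta$ and $B$, such that whenever $\frac1{1-\gamma}\le B$, the output always satisfies $|E|\le C\,(1+\frac1\varepsilon)\,k$. Hence, with at least the probability in 1, $E$ is a $\big(2,C(1+\frac1\varepsilon)\big)$ bi-criteria approximation for $(k,z)_\varepsilon$-center clustering: $\phi_\varepsilon(X,E)\le 2r_{opt}$, with at most $C(1+\frac1\varepsilon)k$ centers. Moreover the algorithm, implemented with deterministic linear-time (median of medians) selection of the farthest points, always runs in at most $C\,(1+\frac1\varepsilon)\,k\,n$ elementary steps (unit cost for a distance look-up, an arithmetical operation or comparison, a list-cell access, and a random draw of an index). For $\varepsilon$ bounded above, these bounds are $O(k/\varepsilon)$ centers and $O\big(\frac k\varepsilon n\big)$ time. -/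

import Mathlib

open scoped ENNReal

universe u v

noncomputable section

namespace KCenter

/-! ### The problem: `k`-center clustering with `z` outliers in a finite metric space -/

section Problem

variable {X : Type u} [Fintype X] [MetricSpace X]

/-- The distance `min_{c ∈ A} d(p, c)` from a vertex `p` to a finite set `A`
(`∞` if `A` is empty, a finite distance otherwise). -/
def distTo (A : Finset X) (p : X) : ℝ≥0∞ := A.inf fun c => edist p c

/-- The clustering cost `max_{p ∈ S} min_{c ∈ A} d(p, c)` of the centers `A` on `S`. -/
def cost (S A : Finset X) : ℝ≥0∞ := S.sup fun p => distTo A p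

/-- `φ_ε(X, A)`: the least cost of the centers `A` on a subset `S ⊆ X` with
`|S| ≥ n - (1 + ε) z`. -/
def phi (z : ℕ) (ε : ℝ) (A : Finset X) : ℝ≥0∞ :=
  ⨅ (S : Finset X) (_ : (Fintype.card X : ℝ) - (1 + ε) * z ≤ (S.card : ℝ)), cost S A

variable (X) in
/-- The optimal cost `r_opt` of `k`-center clustering with `z` outliers: the least cost over all
choices of `S ⊆ X` with `|S| ≥ n - z` and of at most `k` centers in `X`. -/
def rOpt (k z : ℕ) : ℝ≥0∞ :=
  ⨅ (S : Finset X) (_ : Fintype.card X ≤ S.card + z) (A : Finset X) (_ : A.card ≤ k), cost S A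

/-- `A` is an `(α, β)`-bi-criteria approximation for `(k, z)_ε`-center clustering: it has at most
`β k` centers, and `φ_ε(X, A) ≤ α r_opt`. -/
def IsBicriteriaApprox (k z : ℕ) (ε : ℝ) (α : ℝ≥0∞) (β : ℝ) (A : Finset X) : Prop :=
  phi z ε A ≤ α * rOpt X k z ∧ (A.card : ℝ) ≤ β * k

/-- `Q` consists of `m` vertices which are farthest from `E` (ties are broken arbitrarily). -/
def IsFarthest (m : ℕ) (E Q : Finset X) : Prop :=
  Q.card = m ∧ ∀ x ∈ Q, ∀ y ∉ Q, distTo E y ≤ distTo E x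

end Problem

/-! ### The integer parameters of the algorithm -/

/-- Number of vertices drawn at the start: `(1 / (1 - γ)) log (1 / η)` with `γ = z / n`. -/
def firstSize (n z : ℕ) (η : ℝ) : ℕ := ⌈1 / (1 - (z : ℝ) / n) * Real.log (1 / η)⌉₊

/-- Number of vertices drawn in each later round: `((1 + ε) / ε) log (1 / η)`. -/
def roundSize (ε η : ℝ) : ℕ := ⌈(1 + ε) / ε * Real.log (1 / η)⌉₊

/-- Number of farthest vertices: `(1 + ε) z`, and all `n` vertices if that exceeds `n`. -/
def farSize (n z : ℕ) (ε : ℝ) : ℕ := min n ⌈(1 + ε) * z⌉₊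

/-- `t = (k + √k) / (1 - η)`. -/
def numRounds (k : ℕ) (η : ℝ) : ℕ := ⌈((k : ℝ) + √(k : ℝ)) / (1 - η)⌉₊

/-! ### The greedy sampling algorithm -/

section Algorithm

variable {X : Type u}

/-- The law of `s` independent uniform draws from `Q`. -/
def sample (Q : Finset X) : ℕ → PMF (List X)
  | 0 => PMF.pure []
  | s + 1 =>
    if h : Q.Nonempty then
      (PMF.uniformOfFinset Q h).bind fun x => (sample Q s).map fun l => x :: l
    else PMF.pure []

/-- `m` rounds of: draw `s` vertices from the set `Q l` of farthest vertices and put them in front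
of the list `l` of the vertices chosen so far. -/
def rounds (Q : List X → Finset X) (s : ℕ) : ℕ → List X → PMF (List X)
  | 0, l => PMF.pure l
  | m + 1, l => (sample (Q l) s).bind fun a => rounds Q s m (a ++ l)

/-- The greedy sampling algorithm: the law of the list of all chosen vertices; the output `E` is
the set of its members. The counter `j` is `1` at the first draw, made from the whole of `X`, and
then runs up to `t`, so that `t - 1` rounds with farthest vertices follow. The function `Q` says
which farthest vertices are taken, given all choices made so far. -/
def greedy [Fintype X] (Q : List X → Finset X) (k z : ℕ) (ε η : ℝ) : PMF (List X) :=
  (sample Finset.univ (firstSize (Fintype.card X) z η)).bind fun l =>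
    rounds Q (roundSize ε η) (numRounds k η - 1) l

/-- `Q` is a way to select the farthest vertices in the greedy sampling algorithm. -/
def IsFarthestRule [Fintype X] [MetricSpace X] [DecidableEq X] (z : ℕ) (ε : ℝ)
    (Q : List X → Finset X) : Prop :=
  ∀ l : List X, IsFarthest (farSize (Fintype.card X) z ε) l.toFinset (Q l)

end Algorithm

/-! ### Step counting

Every call of one of the functions below (whose name ends in `T`) is charged one step, on top of
the steps of the calls it makes. Apart from those calls, the body of a function does a bounded
number of elementary operations: to read or make a list cell, an arithmetical operation on numbers,
a comparison of two numbers, to look up the distance of two given vertices, to draw a random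
index. -/

/-- A value together with the number of steps spent on it. -/
structure Timed (α : Type u) where
  val : α
  steps : ℕ

namespace Timed

variable {α : Type u} {β : Type v}

def ret (a : α) : Timed α := ⟨a, 0⟩

def bind (x : Timed α) (f : α → Timed β) : Timed β := ⟨(f x.val).val, x.steps + (f x.val).steps⟩

/-- One more step. -/
def tick (x : Timed α) : Timed α := ⟨x.val, x.steps + 1⟩

/-- Sequencing of randomized computations. -/
def bindR (x : PMF (Timed α)) (f : α → PMF (Timed β)) : PMF (Timed β) :=
  PMF.bind x fun a => (f a.val).map fun b => ⟨b.val, a.steps + b.steps⟩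

end Timed

open Timed

section Lists

variable {α : Type u}

def lenT : List α → Timed ℕ
  | [] => tick (ret 0)
  | _ :: l => tick ((lenT l).bind fun m => ret (m + 1))

def appT : List α → List α → Timed (List α)
  | [], r => tick (ret r)
  | a :: l, r => tick ((appT l r).bind fun s => ret (a :: s))

def takeT : ℕ → List α → Timed (List α)
  | 0, _ => tick (ret [])
  | _ + 1, [] => tick (ret [])
  | m + 1, a :: l => tick ((takeT m l).bind fun s => ret (a :: s))

/-- The entry at position `i` of `a :: l`. -/
def getT : α → List α → ℕ → Timed α
  | a, [], _ => tick (ret a)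
  | a, _ :: _, 0 => tick (ret a)
  | _, b :: l, i + 1 => tick (getT b l i)

/-- `s` independent uniform draws from the entries of a list. -/
def sampleT : List α → ℕ → PMF (Timed (List α))
  | _, 0 => PMF.pure (tick (ret []))
  | [], _ + 1 => PMF.pure (tick (ret []))
  | a :: l, s + 1 =>
    bindR (PMF.pure (tick (lenT (a :: l)))) fun _ =>
    bindR ((PMF.uniformOfFintype (Fin (l.length + 1))).map fun i => getT a l i) fun x =>
    bindR (sampleT (a :: l) s) fun r =>
    PMF.pure (ret (x :: r))

end Lists

/-! ### Linear time selection of the entries with the largest keys (median of medians) -/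

section Selection

variable {X : Type u}

/-- Insertion into a list with decreasing keys. -/
def insertT (a : X × ℝ≥0∞) : List (X × ℝ≥0∞) → Timed (List (X × ℝ≥0∞))
  | [] => tick (ret [a])
  | b :: l =>
    if b.2 ≤ a.2 then tick (ret (a :: b :: l))
    else tick ((insertT a l).bind fun r => ret (b :: r))

/-- Insertion sort, by decreasing keys. -/
def sortT : List (X × ℝ≥0∞) → Timed (List (X × ℝ≥0∞))
  | [] => tick (ret [])
  | a :: l => tick ((sortT l).bind fun r => insertT a r)

/-- The medians of the consecutive groups of five (at most four last entries are left out). -/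
def mediansT : List (X × ℝ≥0∞) → Timed (List (X × ℝ≥0∞))
  | a :: b :: c :: d :: e :: l =>
    tick ((sortT [a, b, c, d, e]).bind fun s => (getT a s 2).bind fun m =>
      (mediansT l).bind fun r => ret (m :: r))
  | _ => tick (ret [])

/-- The least of `p` and the keys of a list. -/
def minKeyT (p : ℝ≥0∞) : List (X × ℝ≥0∞) → Timed ℝ≥0∞
  | [] => tick (ret p)
  | a :: l => tick (minKeyT (min p a.2) l)

/-- The entries with key above, equal to, and below `p`. -/
def splitT (p : ℝ≥0∞) : List (X × ℝ≥0∞) →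
    Timed (List (X × ℝ≥0∞) × List (X × ℝ≥0∞) × List (X × ℝ≥0∞))
  | [] => tick (ret ([], [], []))
  | a :: l =>
    tick ((splitT p l).bind fun s =>
      if p < a.2 then ret (a :: s.1, s.2.1, s.2.2)
      else if a.2 < p then ret (s.1, s.2.1, a :: s.2.2)
      else ret (s.1, a :: s.2.1, s.2.2))

/-- `q` entries with the largest keys. The first argument bounds the depth of the recursion; it is
never exhausted if it is at least the length of the list, which decreases with each call. -/
def topT : ℕ → ℕ → List (X × ℝ≥0∞) → Timed (List (X × ℝ≥0∞))
  | 0, q, l => tick (takeT q l)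
  | f + 1, q, l =>
    tick ((lenT l).bind fun m =>
      if m ≤ 100 then (sortT l).bind fun s => takeT q s
      else
        (mediansT l).bind fun M =>
        (lenT M).bind fun r =>
        (topT f ((r + 1) / 2) M).bind fun T =>
        (minKeyT ⊤ T).bind fun p =>
        (splitT p l).bind fun s =>
        (lenT s.1).bind fun g =>
        (lenT s.2.1).bind fun e =>
        if q ≤ g then topT f q s.1
        else if q ≤ g + e then (takeT (q - g) s.2.1).bind fun E => appT s.1 E
        else (topT f (q - g - e) s.2.2).bind fun L => (appT s.2.1 L).bind fun R => appT s.1 R)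

end Selection

/-! ### The greedy sampling algorithm with its step count

A table holds every vertex with its current distance to the set of chosen vertices. -/

section TimedAlgorithm

variable {X : Type u}

def initT : List X → Timed (List (X × ℝ≥0∞))
  | [] => tick (ret [])
  | p :: l => tick ((initT l).bind fun r => ret ((p, ⊤) :: r))

/-- Update of the table for one new center `c`. -/
def updateT [MetricSpace X] (c : X) : List (X × ℝ≥0∞) → Timed (List (X × ℝ≥0∞))
  | [] => tick (ret [])
  | a :: l => tick ((updateT c l).bind fun r => ret ((a.1, min a.2 (edist a.1 c)) :: r))

def updatesT [MetricSpace X] : List X → List (X × ℝ≥0∞) → Timed (List (X × ℝ≥0∞))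
  | [], D => tick (ret D)
  | c :: a, D => tick ((updateT c D).bind fun D' => updatesT a D')

def verticesT : List (X × ℝ≥0∞) → Timed (List X)
  | [] => tick (ret [])
  | a :: l => tick ((verticesT l).bind fun r => ret (a.1 :: r))

/-- `m` rounds with `q` farthest vertices and `s` draws each, from the table `D` (with `n` entries)
and the list `l` of the vertices chosen so far. -/
def roundsT [MetricSpace X] (n q s : ℕ) :
    ℕ → List (X × ℝ≥0∞) → List X → PMF (Timed (List X))
  | 0, _, l => PMF.pure (tick (ret l))
  | m + 1, D, l =>
    bindR (PMF.pure (tick (topT n q D))) fun F =>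
    bindR (PMF.pure (verticesT F)) fun V =>
    bindR (sampleT V s) fun a =>
    bindR (PMF.pure (updatesT a D)) fun D' =>
    bindR (PMF.pure (appT a l)) fun l' =>
    roundsT n q s m D' l'

/-- The greedy sampling algorithm on the list `vs` of all vertices, with its step count. -/
def greedyT [MetricSpace X] (vs : List X) (k z : ℕ) (ε η : ℝ) : PMF (Timed (List X)) :=
  bindR (PMF.pure (tick (lenT vs))) fun n =>
  bindR (PMF.pure (tick (ret (firstSize n z η)))) fun s₁ =>
  bindR (PMF.pure (tick (ret (roundSize ε η)))) fun s =>
  bindR (PMF.pure (tick (ret (farSize n z ε)))) fun q =>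
  bindR (PMF.pure (tick (ret (numRounds k η)))) fun t =>
  bindR (PMF.pure (initT vs)) fun D =>
  bindR (sampleT vs s₁) fun l =>
  bindR (PMF.pure (updatesT l D)) fun D' =>
  roundsT n q s (t - 1) D' l

end TimedAlgorithm

end KCenter

end

noncomputable section

namespace KCenter

/-! ### Probabilities of events under `PMF.bind` -/

section PMF

variable {α : Type u} {β : Type v}

/-! Success probability. Fix an optimal pair of inliers `S` and centers `A`, and let `c` send each
inlier to a center within `r`, the optimum. Two inliers with the same center are at distance at most
`2 * r`, so once every cluster contains a chosen inlier, the chosen points serve all of `S` within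
`2 * r`. The potential is the number of clusters without a chosen inlier (`missed`). As long as the
cost `phi` exceeds `2 * r`, every farthest point is more than `2 * r` away from the chosen points
(`IsFarthest.far_of_lt_phi`), so an inlier among them lies in a cluster not yet hit. At most `z` of
these at least `(1 + ε) * z` points are outliers, so all draws of a round miss the inliers with
probability at most `η`. Hence each round started from a bad state lowers the potential with
probability at least `1 - η`, whatever happened before. The first draw hits an inlier with
probability at least `1 - η`, which leaves a potential of at most `k - 1`. An exponential moment
bound on the potential (`rounds_compl_le`, optimized in `exists_moment_bound`) replaces a martingale
concentration inequality.

Number of centers and running time. Both follow from a bound on the number of draws, which holds for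
every outcome (`draws_le`). Each draw costs time linear in `n`, for picking an entry and updating
the distance table; each round also needs one selection of farthest points, linear by median of
medians (`topT_steps_le`). The timed program has the same output law as the abstract algorithm for
one particular tie-breaking rule (`map_val_greedyT`), so the probability bound covers it. -/

lemma toOuterMeasure_le_one (p : PMF α) (s : Set α) : p.toOuterMeasure s ≤ 1 := by
  rw [PMF.toOuterMeasure_apply, ← p.tsum_coe]
  exact ENNReal.tsum_le_tsum fun a => Set.indicator_le_self' (fun _ _ => zero_le) a

lemma toOuterMeasure_add_compl (p : PMF α) (s : Set α) :
    p.toOuterMeasure s + p.toOuterMeasure sᶜ = 1 := by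
  rw [PMF.toOuterMeasure_apply, PMF.toOuterMeasure_apply, ← ENNReal.tsum_add, ← p.tsum_coe]
  exact tsum_congr fun a => Set.indicator_self_add_compl_apply s p a

/-- Total probability with a two-level bound: the base level `c` is paid always, the surcharge `d`
only on `s`. In this form an upper bound on the probability of `s` suffices. -/
lemma toOuterMeasure_bind_le (p : PMF α) (f : α → PMF β) (t : Set β) (s : Set α) (c d : ℝ≥0∞)
    (hs : ∀ a ∈ s, (f a).toOuterMeasure t ≤ c + d) (hc : ∀ a ∉ s, (f a).toOuterMeasure t ≤ c) :
    (p.bind f).toOuterMeasure t ≤ c + d * p.toOuterMeasure s := by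
  rw [PMF.toOuterMeasure_bind_apply, PMF.toOuterMeasure_apply]
  calc ∑' a, p a * (f a).toOuterMeasure t
      ≤ ∑' a, (p a * c + d * s.indicator p a) := by
        refine ENNReal.tsum_le_tsum fun a => ?_
        by_cases ha : a ∈ s
        · rw [Set.indicator_of_mem ha, mul_comm d, ← mul_add]
          gcongr
          exact hs a ha
        · rw [Set.indicator_of_notMem ha, mul_zero, add_zero]
          gcongr
          exact hc a ha
    _ = c + d * ∑' a, s.indicator p a := by
        rw [ENNReal.tsum_add, ENNReal.tsum_mul_right, p.tsum_coe, one_mul, ENNReal.tsum_mul_left]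

lemma mul_le_toOuterMeasure_bind (p : PMF α) (f : α → PMF β) (t : Set β) (s : Set α) (c : ℝ≥0∞)
    (hs : ∀ a ∈ s, c ≤ (f a).toOuterMeasure t) :
    p.toOuterMeasure s * c ≤ (p.bind f).toOuterMeasure t := by
  rw [PMF.toOuterMeasure_bind_apply, PMF.toOuterMeasure_apply, ← ENNReal.tsum_mul_right]
  refine ENNReal.tsum_le_tsum fun a => ?_
  by_cases ha : a ∈ s
  · rw [Set.indicator_of_mem ha]
    gcongr
    exact hs a ha
  · simp [Set.indicator_of_notMem ha]

end PMF

/-! ### Independent uniform draws -/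

section Sample

variable {X : Type u}

lemma mem_of_mem_support_sample {Q : Finset X} {s : ℕ} :
    ∀ {l : List X}, l ∈ (sample Q s).support → ∀ x ∈ l, x ∈ Q := by
  induction s with
  | zero => intro l hl; simp [sample] at hl; simp [hl]
  | succ s ih =>
    intro l hl
    rw [sample] at hl
    split_ifs at hl with h
    · simp only [PMF.mem_support_bind_iff, PMF.mem_support_map_iff] at hl
      obtain ⟨x, hx, l', hl', rfl⟩ := hl
      rw [PMF.mem_support_uniformOfFinset_iff] at hx
      intro y hy
      rcases List.mem_cons.1 hy with rfl | hy
      · exact hx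
      · exact ih hl' y hy
    · simp at hl; simp [hl]

lemma length_le_of_mem_support_sample {Q : Finset X} {s : ℕ} :
    ∀ {l : List X}, l ∈ (sample Q s).support → l.length ≤ s := by
  induction s with
  | zero => intro l hl; simp [sample] at hl; simp [hl]
  | succ s ih =>
    intro l hl
    rw [sample] at hl
    split_ifs at hl with h
    · simp only [PMF.mem_support_bind_iff, PMF.mem_support_map_iff] at hl
      obtain ⟨x, hx, l', hl', rfl⟩ := hl
      simpa using ih hl'
    · simp at hl; simp [hl]

/-- The probability that all `s` draws miss `S`. -/
lemma sample_miss_le_pow {Q S : Finset X} (hQ : Q.Nonempty) {ρ : ℝ} (hρ : 0 ≤ ρ)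
    [DecidableEq X] (h : ((Q \ S).card : ℝ) ≤ ρ * Q.card) (s : ℕ) :
    (sample Q s).toOuterMeasure {l | ∀ x ∈ l, x ∉ S} ≤ ENNReal.ofReal (ρ ^ s) := by
  induction s with
  | zero => simpa using toOuterMeasure_le_one _ _
  | succ s ih =>
    rw [sample, dif_pos hQ]
    refine (toOuterMeasure_bind_le _ _ _ {x | x ∉ S} 0 (ENNReal.ofReal (ρ ^ s)) ?_ ?_).trans ?_
    · intro x hx
      rw [PMF.toOuterMeasure_map_apply, zero_add]
      refine le_trans ?_ ih
      gcongr
      intro l hl y hy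
      exact hl y (List.mem_cons_of_mem _ hy)
    · intro x hx
      rw [PMF.toOuterMeasure_map_apply, nonpos_iff_eq_zero]
      have : ((fun l => x :: l) ⁻¹' {l : List X | ∀ x ∈ l, x ∉ S}) = ∅ := by
        ext l
        simp only [Set.mem_preimage, Set.mem_ofPred_eq, Set.mem_empty_iff_false, iff_false]
        intro hl
        exact hx (hl x (by simp))
      rw [this]
      simp
    · rw [zero_add, PMF.toOuterMeasure_uniformOfFinset_apply, pow_succ, ENNReal.ofReal_mul (by positivity)]
      gcongr
      have hpos : (0 : ℝ) < Q.card := by exact_mod_cast hQ.card_pos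
      have e : {x ∈ Q | x ∈ {x | x ∉ S}} = Q \ S := by
        ext; simp
      refine ENNReal.div_le_of_le_mul ?_
      have e2 : ((Q.card : ℕ) : ℝ≥0∞) = ENNReal.ofReal (Q.card : ℝ) := by simp
      rw [e2, ← ENNReal.ofReal_mul hρ]
      refine le_trans (le_of_eq ?_) (ENNReal.ofReal_le_ofReal h)
      simp only [ENNReal.ofReal_natCast]
      rw [← e]
      congr!

/-- From `ρ ≤ exp (-(1 - ρ))`. This is where the sample sizes of the algorithm come from, with `ρ`
the proportion of outliers. -/
lemma pow_le_of_log_le {ρ η : ℝ} (hρ : 0 ≤ ρ) (hη : 0 < η) {s : ℕ}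
    (hs : Real.log (1 / η) ≤ (1 - ρ) * s) : ρ ^ s ≤ η := by
  calc ρ ^ s ≤ Real.exp (-(1 - ρ)) ^ s := by
        gcongr
        have := Real.add_one_le_exp (-(1 - ρ))
        linarith
    _ = Real.exp (-((1 - ρ) * s)) := by rw [← Real.exp_nat_mul]; congr 1; ring
    _ ≤ Real.exp (Real.log η) := by
        gcongr
        rw [one_div, Real.log_inv] at hs
        linarith
    _ = η := Real.exp_log hη

lemma sample_miss_le {Q S : Finset X} (hQ : Q.Nonempty) {ρ η : ℝ} (hρ : 0 ≤ ρ) (hη : 0 < η)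
    [DecidableEq X] (h : ((Q \ S).card : ℝ) ≤ ρ * Q.card) {s : ℕ}
    (hs : Real.log (1 / η) ≤ (1 - ρ) * s) :
    (sample Q s).toOuterMeasure {l | ∀ x ∈ l, x ∉ S} ≤ ENNReal.ofReal η :=
  (sample_miss_le_pow hQ hρ h s).trans (ENNReal.ofReal_le_ofReal (pow_le_of_log_le hρ hη hs))

/-! ### Rounds which decrease a potential -/

lemma length_le_of_mem_support_rounds {Q : List X → Finset X} {s m : ℕ} :
    ∀ {l l' : List X}, l' ∈ (rounds Q s m l).support → l'.length ≤ m * s + l.length := by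
  induction m with
  | zero => intro l l' hl; simp [rounds] at hl; simp [hl]
  | succ m ih =>
    intro l l' hl
    rw [rounds] at hl
    simp only [PMF.mem_support_bind_iff] at hl
    obtain ⟨a, ha, hl⟩ := hl
    have h1 := ih hl
    have h2 := length_le_of_mem_support_sample ha
    rw [List.length_append] at h1
    rw [Nat.succ_mul]
    omega

/-- Good states are absorbing, so the potential has to be controlled on bad states only. -/
lemma rounds_compl_eq_zero {Q : List X → Finset X} {s : ℕ} {good : Set (List X)}
    (hgood : ∀ a, ∀ l ∈ good, a ++ l ∈ good) (m : ℕ) :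
    ∀ l ∈ good, (rounds Q s m l).toOuterMeasure goodᶜ = 0 := by
  induction m with
  | zero =>
    intro l hl
    simp [rounds, hl]
  | succ m ih =>
    intro l hl
    rw [rounds, PMF.toOuterMeasure_bind_apply]
    simp [ih _ (hgood _ l hl)]

/-- An exponential moment bound: if every round from a list which is not good decreases the
potential `N` with probability at least `1 - η`, then the lists after `m` rounds are good up to
the stated probability. -/
lemma rounds_compl_le {Q : List X → Finset X} {s : ℕ} {good : Set (List X)} {N : List X → ℕ}
    {η u : ℝ} (hη₀ : 0 ≤ η) (hη₁ : η ≤ 1) (hu : 1 ≤ u)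
    (hgood : ∀ a, ∀ l ∈ good, a ++ l ∈ good) (hN : ∀ l, N l = 0 → l ∈ good)
    (hmono : ∀ a l, N (a ++ l) ≤ N l)
    (hstep : ∀ l ∉ good,
      (sample (Q l) s).toOuterMeasure {a | ¬ N (a ++ l) < N l} ≤ ENNReal.ofReal η) (m : ℕ) :
    ∀ l, (rounds Q s m l).toOuterMeasure goodᶜ ≤
      ENNReal.ofReal (u ^ N l * (η + (1 - η) / u) ^ m) := by
  have hu0 : 0 < u := by linarith
  have hw : 0 ≤ η + (1 - η) / u := add_nonneg hη₀ (div_nonneg (by linarith) hu0.le)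
  induction m with
  | zero =>
    intro l
    refine (toOuterMeasure_le_one _ _).trans ?_
    rw [pow_zero, mul_one]
    exact ENNReal.one_le_ofReal.2 (one_le_pow₀ hu)
  | succ m ih =>
    intro l
    by_cases hl : l ∈ good
    · rw [rounds_compl_eq_zero hgood _ l hl]
      exact zero_le
    · obtain ⟨j, hj⟩ : ∃ j, N l = j + 1 :=
        Nat.exists_eq_succ_of_ne_zero fun h => hl (hN l h)
      set w := η + (1 - η) / u with hwdef
      have hF : u ^ j * w ^ m ≤ u ^ (j + 1) * w ^ m := by
        have : j ≤ j + 1 := by omega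
        gcongr
      rw [rounds]
      -- With `w = η + (1 - η) / u`, a successful round leaves the bound `u ^ j * w ^ m`, a failed
      -- one at most `u ^ (j + 1) * w ^ m`. Charging the difference with probability `η` gives
      -- exactly `u ^ (j + 1) * w ^ (m + 1)`.
      refine (toOuterMeasure_bind_le _ _ _ {a | ¬ N (a ++ l) < N l}
        (ENNReal.ofReal (u ^ j * w ^ m))
        (ENNReal.ofReal (u ^ (j + 1) * w ^ m - u ^ j * w ^ m)) ?_ ?_).trans ?_
      · intro a _
        refine (ih (a ++ l)).trans ?_
        rw [← ENNReal.ofReal_add (by positivity) (by linarith)]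
        apply ENNReal.ofReal_le_ofReal
        rw [add_sub_cancel]
        rw [← hj]
        have := hmono a l
        gcongr
      · intro a ha
        refine (ih (a ++ l)).trans ?_
        apply ENNReal.ofReal_le_ofReal
        simp only [Set.mem_ofPred_eq, not_not] at ha
        have : N (a ++ l) ≤ j := by omega
        gcongr
      · refine (add_le_add_right (mul_le_mul_right (hstep l hl) _) _).trans ?_
        rw [← ENNReal.ofReal_mul (by linarith), ← ENNReal.ofReal_add (by positivity)
          (mul_nonneg (by linarith) hη₀), hj]
        apply ENNReal.ofReal_le_ofReal
        apply le_of_eq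
        rw [hwdef, pow_succ w, hwdef]
        field_simp
        ring

end Sample

/-- The exponential moment bound with `u = exp (√k / (k - 1 + √k))`. -/
lemma exists_moment_bound {η : ℝ} (hη₀ : 0 < η) (hη₁ : η < 1) {k : ℕ} (hk : 0 < k) :
    ∃ u : ℝ, 1 ≤ u ∧ u ^ (k - 1) * (η + (1 - η) / u) ^ (numRounds k η - 1) ≤
      Real.exp (-((1 - η) / 4)) := by
  have hk1 : (1 : ℝ) ≤ k := by exact_mod_cast hk
  set y := √(k : ℝ) with hy
  have hy1 : 1 ≤ y := by rw [hy]; exact Real.one_le_sqrt.2 hk1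
  have hyy : y * y = k := Real.mul_self_sqrt (by linarith)
  have hμ : 0 < (k : ℝ) - 1 + y := by linarith
  set lam := y / ((k : ℝ) - 1 + y) with hlam
  have hlam0 : 0 < lam := by positivity
  refine ⟨Real.exp lam, Real.one_le_exp hlam0.le, ?_⟩
  set p := 1 - η with hp
  have hp0 : 0 < p := by linarith
  set T := numRounds k η - 1 with hT
  -- The first of the `t` draws is not a farthest-point round, so `T` is `t - 1`; the loss is `p ≤
  -- 1`.
  have hTge : (k : ℝ) - 1 + y ≤ p * T := by
    have h1 : ((k : ℝ) + y) / p ≤ numRounds k η := Nat.le_ceil _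
    have h2 : (numRounds k η : ℝ) ≤ T + 1 := by
      have : numRounds k η ≤ T + 1 := by omega
      exact_mod_cast this
    rw [div_le_iff₀ hp0] at h1
    nlinarith
  have hw : η + p / Real.exp lam ≤ Real.exp (-(p * (1 - Real.exp (-lam)))) := by
    have := Real.add_one_le_exp (-(p * (1 - Real.exp (-lam))))
    rw [div_eq_mul_inv, ← Real.exp_neg]
    linarith
  have hw0 : 0 ≤ η + p / Real.exp lam := by positivity
  -- Rests on `exp lam ≥ 1 + lam + lam ^ 2 / 2` and `(1 - lam + lam ^ 2 / 2) * (1 + lam + lam ^ 2 /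
  -- 2) = 1 + lam ^ 4 / 4`.
  have hexp : lam - lam ^ 2 / 2 ≤ 1 - Real.exp (-lam) := by
    have := Real.quadratic_le_exp_of_nonneg hlam0.le
    have h3 : Real.exp (-lam) * Real.exp lam = 1 := by rw [← Real.exp_add]; simp
    have h4 := Real.exp_pos (-lam)
    by_cases h5 : 1 - lam + lam ^ 2 / 2 ≤ 0
    · nlinarith [sq_nonneg (lam - 1)]
    · have h6 : 1 ≤ (1 - lam + lam ^ 2 / 2) * Real.exp lam := by
        nlinarith [sq_nonneg (lam ^ 2)]
      have h7 : Real.exp (-lam) ≤ (1 - lam + lam ^ 2 / 2) * (Real.exp lam * Real.exp (-lam)) := by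
        nlinarith
      rw [mul_comm (Real.exp lam), h3] at h7
      linarith
  calc Real.exp lam ^ (k - 1) * (η + p / Real.exp lam) ^ T
      ≤ Real.exp lam ^ (k - 1) * Real.exp (-(p * (1 - Real.exp (-lam)))) ^ T := by gcongr
    _ = Real.exp (((k : ℝ) - 1) * lam - p * T * (1 - Real.exp (-lam))) := by
        rw [← Real.exp_nat_mul, ← Real.exp_nat_mul, ← Real.exp_add, Nat.cast_sub hk]
        congr 1
        push_cast
        ring
    -- With `μ = k - 1 + y` one has `μ * lam = y`, so the exponent is at most `-(y * lam) / 2`.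
    -- Since `y * lam = k / μ ≥ 1 / 2`, this is at most `-1 / 4`.
    _ ≤ Real.exp (-(p / 4)) := by
        rw [Real.exp_le_exp]
        have h0 : 0 ≤ 1 - Real.exp (-lam) := by
          have : Real.exp (-lam) ≤ 1 := Real.exp_le_one_iff.2 (by linarith)
          linarith
        have h1 : ((k : ℝ) - 1 + y) * (lam - lam ^ 2 / 2) ≤ p * T * (1 - Real.exp (-lam)) :=
          (mul_le_mul_of_nonneg_left hexp hμ.le).trans (mul_le_mul_of_nonneg_right hTge h0)
        have h2 : ((k : ℝ) - 1 + y) * lam = y := by rw [hlam]; field_simp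
        have h3 : 1 / 2 ≤ y * lam := by
          rw [hlam, mul_div_assoc', le_div_iff₀ hμ]
          nlinarith
        have h4 : ((k : ℝ) - 1 + y) * (lam - lam ^ 2 / 2) = y - y * lam / 2 := by
          linear_combination (1 - lam / 2) * h2
        nlinarith

/-! ### The clustering costs -/

section Cost

variable {X : Type u} [MetricSpace X]

lemma distTo_anti {A B : Finset X} (h : A ⊆ B) (p : X) : distTo B p ≤ distTo A p :=
  Finset.inf_mono h

lemma cost_anti {A B : Finset X} (h : A ⊆ B) (S : Finset X) : cost S B ≤ cost S A :=
  Finset.sup_mono_fun fun p _ => distTo_anti h p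

lemma edist_le_two_mul_of_same_center {c : X → X} {x y : X} {r : ℝ≥0∞}
    (hx : edist x (c x) ≤ r) (hy : edist y (c y) ≤ r) (h : c y = c x) : edist x y ≤ 2 * r := by
  calc edist x y ≤ edist x (c x) + edist (c x) y := edist_triangle _ _ _
    _ ≤ r + r := by
        gcongr
        rwa [← h, edist_comm]
    _ = 2 * r := (two_mul r).symm

variable [Fintype X]

lemma phi_anti {A B : Finset X} (h : A ⊆ B) (z : ℕ) (ε : ℝ) : phi z ε B ≤ phi z ε A :=
  iInf₂_mono fun S _ => cost_anti h S

lemma phi_le_cost {z : ℕ} {ε : ℝ} {S A : Finset X}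
    (h : (Fintype.card X : ℝ) - (1 + ε) * z ≤ (S.card : ℝ)) : phi z ε A ≤ cost S A :=
  iInf₂_le S h

variable (X) in
lemma exists_cost_eq_rOpt (k z : ℕ) :
    ∃ S A : Finset X, Fintype.card X ≤ S.card + z ∧ A.card ≤ k ∧ cost S A = rOpt X k z := by
  let ι := {P : Finset X × Finset X // Fintype.card X ≤ P.1.card + z ∧ P.2.card ≤ k}
  have : Nonempty ι := ⟨⟨(Finset.univ, ∅), by simp⟩⟩
  obtain ⟨⟨⟨S, A⟩, hS, hA⟩, hmin⟩ := Finite.exists_min (fun P : ι => cost P.1.1 P.1.2)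
  refine ⟨S, A, hS, hA, le_antisymm ?_ ?_⟩
  · exact le_iInf₂ fun S' hS' => le_iInf₂ fun A' hA' => hmin ⟨(S', A'), hS', hA'⟩
  · exact (iInf₂_le S hS).trans (iInf₂_le A hA)

/-- If the clustering cost of `E` is large, then there are many farthest points, and all of them
are far away from `E`. -/
lemma IsFarthest.far_of_lt_phi [DecidableEq X] {z : ℕ} {ε : ℝ} (hε : 0 < ε) {E Q : Finset X}
    {r : ℝ≥0∞} (hQ : IsFarthest (farSize (Fintype.card X) z ε) E Q) (h : r < phi z ε E) :
    (1 + ε) * z ≤ (Q.card : ℝ) ∧ ∀ x ∈ Q, r < distTo E x := by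
  -- Otherwise the empty set is admissible in `phi`, which then vanishes.
  have hn : (1 + ε) * z < (Fintype.card X : ℝ) := by
    by_contra hcon
    have h1 : phi z ε E ≤ cost ∅ E := phi_le_cost (by simp; linarith)
    simp [cost] at h1
    simp [h1] at h
  have hceil : ⌈(1 + ε) * z⌉₊ ≤ Fintype.card X := Nat.ceil_le.2 hn.le
  have hcard : Q.card = ⌈(1 + ε) * z⌉₊ := by rw [hQ.1, farSize, min_eq_right hceil]
  refine ⟨hcard ▸ Nat.le_ceil _, fun x hx => ?_⟩
  by_contra hcon
  rw [not_lt] at hcon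
  -- If `x ∈ Q` were within `r`, so would be everything outside `Q`. The extra point `x` makes up
  -- for the rounding in the size of `Q`, so `insert x Qᶜ` is large enough for `phi`.
  refine absurd h (not_lt.2 ((phi_le_cost (S := insert x Qᶜ) ?_).trans ?_))
  · rw [Finset.card_insert_of_notMem (by simpa using hx), Finset.card_compl, Nat.cast_add,
      Nat.cast_sub (hcard ▸ hceil), hcard]
    have := Nat.ceil_lt_add_one (show 0 ≤ (1 + ε) * z by positivity)
    push_cast
    linarith
  · refine Finset.sup_le fun y hy => ?_
    rcases Finset.mem_insert.1 hy with rfl | hy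
    · exact hcon
    · exact (hQ.2 x hx y (by simpa using hy)).trans hcon

end Cost

/-! ### Clusters which are not yet hit -/

section Clusters

variable {X : Type u} [DecidableEq X]

/-- The number of centers in `A` of those clusters which contain no inlier (that is, member of
`S`) of the list `l`, where `c` maps a vertex to the center of its cluster. -/
def missed (S A : Finset X) (c : X → X) (l : List X) : ℕ :=
  (A.filter fun a => ∀ x ∈ l, x ∈ S → c x ≠ a).card

lemma missed_append_le (S A : Finset X) (c : X → X) (a l : List X) :
    missed S A c (a ++ l) ≤ missed S A c l := by
  refine Finset.card_le_card fun b hb => ?_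
  rw [Finset.mem_filter] at hb ⊢
  exact ⟨hb.1, fun x hx => hb.2 x (List.mem_append_right _ hx)⟩

lemma missed_lt_of_mem {S A : Finset X} {c : X → X} {l : List X} {x : X} (hxl : x ∈ l)
    (hxS : x ∈ S) (hcx : c x ∈ A) : missed S A c l < A.card := by
  refine Finset.card_lt_card ?_
  rw [Finset.filter_ssubset]
  exact ⟨c x, hcx, fun h => h x hxl hxS rfl⟩

lemma missed_append_lt {S A : Finset X} {c : X → X} {a l : List X} {x : X} (hxa : x ∈ a)
    (hxS : x ∈ S) (hcx : c x ∈ A) (hnew : ∀ y ∈ l, y ∈ S → c y ≠ c x) :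
    missed S A c (a ++ l) < missed S A c l := by
  refine Finset.card_lt_card ((Finset.ssubset_iff_of_subset fun b hb => ?_).2 ⟨c x, ?_, ?_⟩)
  · rw [Finset.mem_filter] at hb ⊢
    exact ⟨hb.1, fun x hx => hb.2 x (List.mem_append_right _ hx)⟩
  · rw [Finset.mem_filter]
    exact ⟨hcx, hnew⟩
  · rw [Finset.mem_filter]
    exact fun h => h.2 x (List.mem_append_left _ hxa) hxS rfl

variable [MetricSpace X]

lemma cost_le_of_missed_eq_zero {S A : Finset X} {c : X → X} {r : ℝ≥0∞}
    (hc : ∀ x ∈ S, c x ∈ A ∧ edist x (c x) ≤ r) {l : List X} (h : missed S A c l = 0) :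
    cost S l.toFinset ≤ 2 * r := by
  refine Finset.sup_le fun x hx => ?_
  rw [missed, Finset.card_eq_zero, Finset.filter_eq_empty_iff] at h
  have := h (hc x hx).1
  push Not at this
  obtain ⟨y, hyl, hyS, hy⟩ := this
  exact (Finset.inf_le (List.mem_toFinset.2 hyl)).trans
    (edist_le_two_mul_of_same_center (hc x hx).2 (hc y hyS).2 hy)

end Clusters

/-! ### The success probability -/

lemma firstSize_ge {n z : ℕ} (hz : z < n) (η : ℝ) :
    Real.log (1 / η) ≤ (1 - (z : ℝ) / n) * firstSize n z η := by
  have hn : (0 : ℝ) < n := by exact_mod_cast (Nat.zero_le z).trans_lt hz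
  have hz' : (z : ℝ) < n := by exact_mod_cast hz
  have h0 : 0 < 1 - (z : ℝ) / n := by
    rw [sub_pos, div_lt_one hn]
    exact hz'
  have h1 : 1 / (1 - (z : ℝ) / n) * Real.log (1 / η) ≤ firstSize n z η := Nat.le_ceil _
  rwa [one_div, inv_mul_le_iff₀ h0] at h1

lemma roundSize_ge {ε : ℝ} (hε : 0 < ε) (η : ℝ) :
    Real.log (1 / η) ≤ (1 - 1 / (1 + ε)) * roundSize ε η := by
  have h1 : (1 + ε) / ε * Real.log (1 / η) ≤ roundSize ε η := Nat.le_ceil _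
  have h2 : (1 - 1 / (1 + ε)) = ((1 + ε) / ε)⁻¹ := by field_simp; ring
  rw [h2]
  rwa [← div_eq_inv_mul, le_div_iff₀' (by positivity)]

theorem success_probability {X : Type u} [Fintype X] [DecidableEq X] [MetricSpace X] {k z : ℕ}
    {η ε : ℝ} (hη₀ : 0 < η) (hη₁ : η < 1) {Q : List X → Finset X} (hk : 0 < k) (hz : 0 < z)
    (hzn : z < Fintype.card X) (hε : 0 < ε) (hQ : IsFarthestRule z ε Q) :
    ENNReal.ofReal ((1 - η) * (1 - Real.exp (-((1 - η) / 4)))) ≤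
      (greedy Q k z ε η).toOuterMeasure {l | phi z ε l.toFinset ≤ 2 * rOpt X k z} := by
  obtain ⟨S, A, hS, hA, hSA⟩ := exists_cost_eq_rOpt X k z
  set r := rOpt X k z with hr
  set good : Set (List X) := {l | phi z ε l.toFinset ≤ 2 * r} with hgooddef
  have hSne : S.Nonempty := by
    rw [← Finset.card_pos]
    omega
  have hη' : 0 ≤ 1 - η := by linarith
  have hp1 : Real.exp (-((1 - η) / 4)) ≤ 1 := Real.exp_le_one_iff.2 (by linarith)
  -- a set of inliers with their centers, unless the optimum is infinite
  obtain ⟨c, hc⟩ : ∃ c : X → X, ∀ x ∈ S, r ≠ ⊤ → c x ∈ A ∧ edist x (c x) ≤ r := by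
    have : ∀ x, ∃ a, x ∈ S → r ≠ ⊤ → a ∈ A ∧ edist x a ≤ r := by
      intro x
      by_cases hx : x ∈ S
      · by_cases htop : r = ⊤
        · exact ⟨x, fun _ h => absurd htop h⟩
        · have h1 : distTo A x ≤ r := by
            rw [← hSA]
            exact Finset.le_sup (f := fun p => distTo A p) hx
          have hAne : A.Nonempty := by
            rw [Finset.nonempty_iff_ne_empty]
            rintro rfl
            simp [distTo] at h1
            exact htop h1
          obtain ⟨a, ha, h2⟩ := Finset.exists_mem_eq_inf A hAne fun c => edist x c
          exact ⟨a, fun _ _ => ⟨ha, by rw [← h2]; exact h1⟩⟩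
      · exact ⟨x, fun h => absurd h hx⟩
    choose c hc using this
    exact ⟨c, hc⟩
  -- For `k > 0` the optimum is in fact finite; it is simpler to note that an infinite one makes
  -- every output good.
  by_cases htop : r = ⊤
  · have h1 : good = Set.univ := by
      ext l
      simp [hgooddef, htop]
    have h2 := toOuterMeasure_add_compl (greedy Q k z ε η) good
    rw [h1] at h2 ⊢
    simp only [Set.compl_univ, MeasureTheory.measure_empty, add_zero] at h2
    rw [h2, ← ENNReal.ofReal_one]
    apply ENNReal.ofReal_le_ofReal
    have := Real.exp_pos (-((1 - η) / 4))
    nlinarith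
  replace hc : ∀ x ∈ S, c x ∈ A ∧ edist x (c x) ≤ r := fun x hx => hc x hx htop
  have hQne : ∀ l, (Q l).Nonempty := by
    intro l
    rw [← Finset.card_pos, (hQ l).1, farSize]
    have : 0 < ⌈(1 + ε) * z⌉₊ := Nat.ceil_pos.2 (by positivity)
    omega
  have hgood : ∀ a, ∀ l ∈ good, a ++ l ∈ good := by
    intro a l hl
    refine (phi_anti ?_ z ε).trans hl
    intro x hx
    simp only [List.mem_toFinset, List.mem_append] at hx ⊢
    exact Or.inr hx
  have hScard : (Fintype.card X : ℝ) ≤ S.card + z := by exact_mod_cast hS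
  have hdiff : ∀ P : Finset X, ((P \ S).card : ℝ) ≤ z := by
    intro P
    have h1 : (P \ S).card ≤ Sᶜ.card := Finset.card_le_card fun x hx => by
      simp only [Finset.mem_sdiff] at hx
      simpa using hx.2
    rw [Finset.card_compl] at h1
    have : (P \ S).card ≤ z := by omega
    exact_mod_cast this
  have hN : ∀ l, missed S A c l = 0 → l ∈ good := by
    intro l hl
    refine (phi_le_cost (S := S) ?_).trans (cost_le_of_missed_eq_zero hc hl)
    nlinarith [mul_nonneg hε.le (Nat.cast_nonneg (α := ℝ) z)]
  have hstep : ∀ l ∉ good, (sample (Q l) (roundSize ε η)).toOuterMeasure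
      {a | ¬ missed S A c (a ++ l) < missed S A c l} ≤ ENNReal.ofReal η := by
    intro l hl
    obtain ⟨hcard, hfar⟩ := (hQ l).far_of_lt_phi hε (not_le.1 hl)
    -- The inclusion of events is needed on the support only, where all drawn points belong to `Q
    -- l`.
    refine le_trans (PMF.toOuterMeasure_mono _ ?_)
      (sample_miss_le (S := S) (hQne l) (ρ := 1 / (1 + ε)) (by positivity) hη₀ ?_
        (roundSize_ge hε η))
    · rintro a ⟨ha, hsupp⟩ x hxa hxS
      refine ha (missed_append_lt hxa hxS (hc x hxS).1 fun y hyl hyS hyx => ?_)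
      have h1 := hfar x (mem_of_mem_support_sample hsupp x hxa)
      have h2 : distTo l.toFinset x ≤ edist x y := Finset.inf_le (List.mem_toFinset.2 hyl)
      exact absurd (h1.trans_le h2)
        (not_lt.2 (edist_le_two_mul_of_same_center (hc x hxS).2 (hc y hyS).2 hyx))
    · refine (hdiff _).trans ?_
      rw [one_div, le_inv_mul_iff₀ (by positivity)]
      exact hcard
  obtain ⟨u, hu, hbound⟩ := exists_moment_bound hη₀ hη₁ hk
  have hrounds := rounds_compl_le hη₀.le hη₁.le hu hgood hN (missed_append_le S A c) hstep
    (numRounds k η - 1)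
  have hfirst : ENNReal.ofReal (1 - η) ≤
      (sample Finset.univ (firstSize (Fintype.card X) z η)).toOuterMeasure
        {l : List X | ∀ x ∈ l, x ∉ S}ᶜ := by
    have hne : (Finset.univ : Finset X).Nonempty := hSne.mono (Finset.subset_univ _)
    have hn : (0 : ℝ) < Fintype.card X := by exact_mod_cast (Nat.zero_le z).trans_lt hzn
    have h1 := sample_miss_le (S := S) hne (ρ := (z : ℝ) / Fintype.card X) (by positivity) hη₀
      (by rw [Finset.card_univ, div_mul_cancel₀ _ hn.ne']; exact hdiff _) (firstSize_ge hzn η)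
    have h2 := toOuterMeasure_add_compl (sample Finset.univ (firstSize (Fintype.card X) z η))
      {l : List X | ∀ x ∈ l, x ∉ S}
    rw [ENNReal.ofReal_sub _ hη₀.le, ENNReal.ofReal_one, ← h2]
    exact tsub_le_iff_left.2 (add_le_add_left h1 _)
  rw [ENNReal.ofReal_mul hη', greedy]
  refine (mul_le_mul_left hfirst _).trans (mul_le_toOuterMeasure_bind _ _ _ _ _ fun l hl => ?_)
  have hlt : missed S A c l ≤ k - 1 := by
    simp only [Set.mem_compl_iff, Set.mem_ofPred_eq, not_forall, not_not] at hl
    obtain ⟨x, hxl, hxS⟩ := hl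
    have := missed_lt_of_mem hxl hxS (hc x hxS).1
    omega
  have h1 : (rounds Q (roundSize ε η) (numRounds k η - 1) l).toOuterMeasure goodᶜ ≤
      ENNReal.ofReal (Real.exp (-((1 - η) / 4))) := by
    refine (hrounds l).trans (ENNReal.ofReal_le_ofReal (le_trans ?_ hbound))
    have : 0 ≤ η + (1 - η) / u := by positivity
    gcongr
  have h2 := toOuterMeasure_add_compl (rounds Q (roundSize ε η) (numRounds k η - 1) l) good
  rw [ENNReal.ofReal_sub _ (Real.exp_pos _).le, ENNReal.ofReal_one, ← h2]
  exact tsub_le_iff_right.2 (add_le_add_right h1 _)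

/-! ### The number of centers -/

lemma length_le_of_mem_support_greedy {X : Type u} [Fintype X] {Q : List X → Finset X} {k z : ℕ}
    {ε η : ℝ} {l : List X} (hl : l ∈ (greedy Q k z ε η).support) :
    l.length ≤ (numRounds k η - 1) * roundSize ε η + firstSize (Fintype.card X) z η := by
  rw [greedy] at hl
  simp only [PMF.mem_support_bind_iff] at hl
  obtain ⟨a, ha, hl⟩ := hl
  have h1 := length_le_of_mem_support_rounds hl
  have h2 := length_le_of_mem_support_sample ha
  omega

/-- A common bound for the number of draws and the number of rounds. -/
lemma draws_le {η : ℝ} (hη₀ : 0 < η) (hη₁ : η < 1) (B : ℝ) :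
    ∃ C : ℝ, 0 < C ∧ ∀ (n k z : ℕ) (ε : ℝ), 0 < k → 0 < ε → 1 / (1 - (z : ℝ) / n) ≤ B →
      (((numRounds k η - 1) * (roundSize ε η + 1) + firstSize n z η + 1 : ℕ) : ℝ) ≤
        C * (1 + 1 / ε) * k := by
  set L := Real.log (1 / η) with hL
  have hL0 : 0 < L := Real.log_pos ((one_lt_div hη₀).2 hη₁)
  have hp : 0 < 1 - η := by linarith
  -- With `e = 1 + 1 / ε`: the number of later rounds is at most `2 * k / (1 - η)` because `√k ≤ k`,
  -- each contributes at most `e * L + 2 ≤ e * (L + 2)`, and the first draw at most `|B| * L + 2`.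
  refine ⟨2 / (1 - η) * (L + 2) + (|B| * L + 2), by positivity, ?_⟩
  intro n k z ε hk hε hB
  have hk1 : (1 : ℝ) ≤ k := by exact_mod_cast hk
  have hfirst : (firstSize n z η : ℝ) ≤ |B| * L + 1 := by
    have h1 : firstSize n z η ≤ ⌈|B| * L⌉₊ :=
      Nat.ceil_mono (mul_le_mul_of_nonneg_right (hB.trans (le_abs_self B)) hL0.le)
    have h2 := Nat.ceil_lt_add_one (show 0 ≤ |B| * L by positivity)
    have h3 : (firstSize n z η : ℝ) ≤ ⌈|B| * L⌉₊ := by exact_mod_cast h1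
    linarith
  set e := 1 + 1 / ε with he
  have he1 : 1 ≤ e := by
    have : 0 ≤ 1 / ε := by positivity
    linarith
  have hround : (roundSize ε η : ℝ) ≤ e * L + 1 := by
    have h1 : (1 + ε) / ε = e := by rw [he]; field_simp; ring
    have h2 := Nat.ceil_lt_add_one (show 0 ≤ (1 + ε) / ε * L by positivity)
    rw [roundSize, ← hL]
    rw [h1] at h2 ⊢
    exact h2.le
  have hnum : ((numRounds k η - 1 : ℕ) : ℝ) ≤ 2 / (1 - η) * k := by
    have h0 : 0 ≤ ((k : ℝ) + √(k : ℝ)) / (1 - η) := by positivity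
    have h1 : (numRounds k η : ℝ) < ((k : ℝ) + √(k : ℝ)) / (1 - η) + 1 := Nat.ceil_lt_add_one h0
    have h2 : 1 ≤ numRounds k η := Nat.ceil_pos.2 (by positivity)
    have h3 : √(k : ℝ) ≤ k := Real.sqrt_le_iff.2 ⟨by linarith, by nlinarith⟩
    rw [Nat.cast_sub h2]
    have h4 : ((k : ℝ) + √(k : ℝ)) / (1 - η) ≤ 2 / (1 - η) * k := by
      rw [div_mul_eq_mul_div]
      gcongr
      linarith
    push_cast
    linarith
  push_cast
  have h1 : ((numRounds k η - 1 : ℕ) : ℝ) * ((roundSize ε η : ℝ) + 1) ≤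
      2 / (1 - η) * k * (e * (L + 2)) := by
    gcongr
    nlinarith
  have h2 : |B| * L + 2 ≤ (|B| * L + 2) * e * k := by
    have h3 : 0 ≤ |B| * L + 2 := by positivity
    have h4 : 1 ≤ e * k := by nlinarith
    nlinarith
  nlinarith

open Timed

/-! ### Values and steps of the list operations -/

section ListOperations

variable {α : Type u}

lemma lenT_val (l : List α) : (lenT l).val = l.length := by
  induction l with
  | nil => rfl
  | cons a l ih => simp [lenT, tick, Timed.bind, ret, ih]

lemma lenT_steps (l : List α) : (lenT l).steps = l.length + 1 := by
  induction l with
  | nil => rfl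
  | cons a l ih => simp [lenT, tick, Timed.bind, ret, ih]

lemma appT_val (l r : List α) : (appT l r).val = l ++ r := by
  induction l with
  | nil => rfl
  | cons a l ih => simp [appT, tick, Timed.bind, ret, ih]

lemma appT_steps (l r : List α) : (appT l r).steps = l.length + 1 := by
  induction l with
  | nil => rfl
  | cons a l ih => simp [appT, tick, Timed.bind, ret, ih]

lemma takeT_val (m : ℕ) (l : List α) : (takeT m l).val = l.take m := by
  induction m generalizing l with
  | zero => simp [takeT, tick, ret]
  | succ m ih => cases l with
    | nil => rfl
    | cons a l => simp [takeT, tick, Timed.bind, ret, ih]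

lemma takeT_steps_le (m : ℕ) (l : List α) : (takeT m l).steps ≤ l.length + 1 := by
  induction m generalizing l with
  | zero => simp [takeT, tick, ret]
  | succ m ih => cases l with
    | nil => simp [takeT, tick, ret]
    | cons a l => simpa [takeT, tick, Timed.bind, ret] using ih l

lemma getT_val (a : α) (l : List α) (i : ℕ) (hi : i < (a :: l).length) :
    (getT a l i).val = (a :: l)[i] := by
  induction l generalizing a i with
  | nil =>
    obtain rfl : i = 0 := by simpa using hi
    rfl
  | cons b l ih => cases i with
    | zero => rfl
    | succ i => simpa [getT, tick] using ih b i (by simpa using hi)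

lemma getT_steps_le (a : α) (l : List α) (i : ℕ) : (getT a l i).steps ≤ l.length + 1 := by
  induction l generalizing a i with
  | nil => simp [getT, tick, ret]
  | cons b l ih => cases i with
    | zero => simp [getT, tick, ret]
    | succ i => simpa [getT, tick] using ih b i

end ListOperations

/-! ### Sorting, medians and splitting -/

section Selection

variable {X : Type u}

lemma insertT_perm (a : X × ℝ≥0∞) (l : List (X × ℝ≥0∞)) : (insertT a l).val.Perm (a :: l) := by
  induction l with
  | nil => simp [insertT, tick, ret]
  | cons b l ih =>
    rw [insertT]
    split_ifs
    · simp [tick, ret]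
    · exact (ih.cons b).trans (List.Perm.swap _ _ _)

lemma insertT_pairwise (a : X × ℝ≥0∞) {l : List (X × ℝ≥0∞)}
    (hl : l.Pairwise fun x y => y.2 ≤ x.2) :
    (insertT a l).val.Pairwise fun x y => y.2 ≤ x.2 := by
  induction l with
  | nil => simp [insertT, tick, ret]
  | cons b l ih =>
    rw [List.pairwise_cons] at hl
    rw [insertT]
    split_ifs with h
    · simp only [tick, ret, List.pairwise_cons]
      refine ⟨fun x hx => ?_, hl⟩
      rcases List.mem_cons.1 hx with rfl | hx
      · exact h
      · exact (hl.1 x hx).trans h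
    · simp only [tick, ret, Timed.bind, List.pairwise_cons]
      refine ⟨fun x hx => ?_, ih hl.2⟩
      rcases List.mem_cons.1 ((insertT_perm a l).mem_iff.1 hx) with rfl | hx
      · exact (not_le.1 h).le
      · exact hl.1 x hx

lemma insertT_steps_le (a : X × ℝ≥0∞) (l : List (X × ℝ≥0∞)) :
    (insertT a l).steps ≤ l.length + 1 := by
  induction l with
  | nil => simp [insertT, tick, ret]
  | cons b l ih =>
    rw [insertT]
    split_ifs
    · simp [tick, ret]
    · simpa [tick, Timed.bind, ret] using ih

lemma sortT_perm (l : List (X × ℝ≥0∞)) : (sortT l).val.Perm l := by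
  induction l with
  | nil => simp [sortT, tick, ret]
  | cons a l ih => exact (insertT_perm a _).trans (ih.cons a)

lemma sortT_pairwise (l : List (X × ℝ≥0∞)) : (sortT l).val.Pairwise fun x y => y.2 ≤ x.2 := by
  induction l with
  | nil => simp [sortT, tick, ret]
  | cons a l ih => exact insertT_pairwise a ih

lemma sortT_steps_le (l : List (X × ℝ≥0∞)) : (sortT l).steps ≤ (l.length + 1) ^ 2 := by
  induction l with
  | nil => simp [sortT, tick, ret]
  | cons a l ih =>
    have h1 := insertT_steps_le a (sortT l).val
    rw [(sortT_perm l).length_eq] at h1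
    simp only [sortT, tick, Timed.bind, List.length_cons]
    nlinarith

/-- The representative of a group of five is the entry next to the largest one in the sorted
group. -/
lemma exists_sorted_five (a b c d e : X × ℝ≥0∞) :
    ∃ s₀ m s₂ s₃ s₄ : X × ℝ≥0∞, (sortT [a, b, c, d, e]).val = [s₀, m, s₂, s₃, s₄] ∧
      (getT a (sortT [a, b, c, d, e]).val 2).val = m ∧ m.2 ≤ s₀.2 ∧ s₂.2 ≤ m.2 ∧ s₃.2 ≤ m.2 ∧
      s₄.2 ≤ m.2 := by
  have hlen := (sortT_perm [a, b, c, d, e]).length_eq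
  have hsort := sortT_pairwise [a, b, c, d, e]
  generalize (sortT [a, b, c, d, e]).val = s at hlen hsort
  match s, hlen with
  | [s₀, m, s₂, s₃, s₄], _ =>
    simp only [List.pairwise_cons, List.mem_cons] at hsort
    exact ⟨s₀, m, s₂, s₃, s₄, rfl, rfl, hsort.1 m (by simp), hsort.2.1 s₂ (by simp),
      hsort.2.1 s₃ (by simp), hsort.2.1 s₄ (by simp)⟩

lemma mediansT_length (l : List (X × ℝ≥0∞)) : (mediansT l).val.length = l.length / 5 := by
  induction l using mediansT.induct with
  | case1 a b c d e l ih =>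
    simp only [mediansT, tick, Timed.bind, ret, List.length_cons, ih]
    omega
  | case2 l h =>
    rw [mediansT.eq_2 l h]
    match l, h with
    | [], _ => simp [tick, ret]
    | [_], _ => simp [tick, ret]
    | [_, _], _ => simp [tick, ret]
    | [_, _, _], _ => simp [tick, ret]
    | [_, _, _, _], _ => simp [tick, ret]
    | a :: b :: c :: d :: e :: l, h => exact (h a b c d e l rfl).elim

lemma mem_of_mem_mediansT (l : List (X × ℝ≥0∞)) : ∀ x ∈ (mediansT l).val, x ∈ l := by
  induction l using mediansT.induct with
  | case1 a b c d e l ih =>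
    obtain ⟨s₀, m, s₂, s₃, s₄, hs, hm, -⟩ := exists_sorted_five a b c d e
    intro x hx
    simp only [mediansT, tick, Timed.bind, ret, List.mem_cons, hm] at hx
    rcases hx with rfl | hx
    · have : x ∈ [a, b, c, d, e] := (sortT_perm _).mem_iff.1 (by rw [hs]; simp)
      have h2 := List.mem_append_left l this
      exact h2
    · have := ih x hx
      simp [this]
  | case2 l h =>
    rw [mediansT.eq_2 l h]
    simp [tick, ret]

/-- A representative with key at least `p` brings along the largest entry of its group. The
companion bound below has factor 4, as a representative dominates three others besides itself. -/
lemma two_mul_countP_mediansT_le (p : ℝ≥0∞) (l : List (X × ℝ≥0∞)) :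
    2 * (mediansT l).val.countP (fun x => p ≤ x.2) ≤ l.countP fun x => p ≤ x.2 := by
  induction l using mediansT.induct with
  | case1 a b c d e l ih =>
    obtain ⟨s₀, m, s₂, s₃, s₄, hs, hm, h0, -⟩ := exists_sorted_five a b c d e
    have h1 := (sortT_perm [a, b, c, d, e]).countP_eq (fun x => decide (p ≤ x.2))
    have h2 : List.countP (fun x => decide (p ≤ x.2)) (a :: b :: c :: d :: e :: l) =
        List.countP (fun x => decide (p ≤ x.2)) [a, b, c, d, e] +
          List.countP (fun x => decide (p ≤ x.2)) l := by
      rw [← List.countP_append]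
      rfl
    rw [h2, ← h1, hs]
    simp only [mediansT, tick, Timed.bind, ret, hm, List.countP_cons]
    by_cases h : p ≤ m.2
    · simp only [h, h.trans h0, decide_true, if_true]
      omega
    · simp only [h, decide_false, Bool.false_eq_true, if_false]
      omega
  | case2 l h =>
    rw [mediansT.eq_2 l h]
    simp [tick, ret]

lemma four_mul_countP_mediansT_le (p : ℝ≥0∞) (l : List (X × ℝ≥0∞)) :
    4 * (mediansT l).val.countP (fun x => x.2 ≤ p) ≤ l.countP fun x => x.2 ≤ p := by
  induction l using mediansT.induct with
  | case1 a b c d e l ih =>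
    obtain ⟨s₀, m, s₂, s₃, s₄, hs, hm, -, h2, h3, h4⟩ := exists_sorted_five a b c d e
    have e1 := (sortT_perm [a, b, c, d, e]).countP_eq (fun x => decide (x.2 ≤ p))
    have e2 : List.countP (fun x => decide (x.2 ≤ p)) (a :: b :: c :: d :: e :: l) =
        List.countP (fun x => decide (x.2 ≤ p)) [a, b, c, d, e] +
          List.countP (fun x => decide (x.2 ≤ p)) l := by
      rw [← List.countP_append]
      rfl
    rw [e2, ← e1, hs]
    simp only [mediansT, tick, Timed.bind, ret, hm, List.countP_cons]
    by_cases h : m.2 ≤ p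
    · simp only [h, h2.trans h, h3.trans h, h4.trans h, decide_true, if_true]
      omega
    · simp only [h, decide_false, Bool.false_eq_true, if_false]
      omega
  | case2 l h =>
    rw [mediansT.eq_2 l h]
    simp [tick, ret]

lemma mediansT_steps_le (l : List (X × ℝ≥0∞)) : (mediansT l).steps ≤ 9 * l.length + 1 := by
  induction l using mediansT.induct with
  | case1 a b c d e l ih =>
    have h1 := sortT_steps_le [a, b, c, d, e]
    have h2 := getT_steps_le a (sortT [a, b, c, d, e]).val 2
    rw [(sortT_perm _).length_eq] at h2
    simp only [List.length_cons, List.length_nil] at h1 h2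
    norm_num at h1
    simp only [mediansT, tick, Timed.bind, ret, List.length_cons]
    omega
  | case2 l h =>
    rw [mediansT.eq_2 l h]
    simp [tick, ret]

lemma minKeyT_steps (p : ℝ≥0∞) (l : List (X × ℝ≥0∞)) : (minKeyT p l).steps = l.length + 1 := by
  induction l generalizing p with
  | nil => rfl
  | cons a l ih => simp [minKeyT, tick, ih]

lemma minKeyT_val_le (p : ℝ≥0∞) (l : List (X × ℝ≥0∞)) :
    (minKeyT p l).val ≤ p ∧ ∀ x ∈ l, (minKeyT p l).val ≤ x.2 := by
  induction l generalizing p with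
  | nil => simp [minKeyT, tick, ret]
  | cons a l ih =>
    obtain ⟨h1, h2⟩ := ih (min p a.2)
    refine ⟨h1.trans (min_le_left _ _), fun x hx => ?_⟩
    rcases List.mem_cons.1 hx with rfl | hx
    · exact h1.trans (min_le_right _ _)
    · exact h2 x hx

lemma minKeyT_val_eq (p : ℝ≥0∞) (l : List (X × ℝ≥0∞)) :
    (minKeyT p l).val = p ∨ ∃ x ∈ l, x.2 = (minKeyT p l).val := by
  induction l generalizing p with
  | nil => simp [minKeyT, tick, ret]
  | cons a l ih =>
    simp only [minKeyT, tick]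
    rcases ih (min p a.2) with h | ⟨x, hx, h⟩
    · rcases min_choice p a.2 with h' | h'
      · exact Or.inl (h.trans h')
      · exact Or.inr ⟨a, by simp, by rw [h, h']⟩
    · exact Or.inr ⟨x, by simp [hx], h⟩

/-- The starting value `⊤` does no harm: if it is the minimum, then all keys are `⊤`. -/
lemma exists_mem_key_eq_minKeyT {l : List (X × ℝ≥0∞)} (hl : l ≠ []) :
    ∃ x ∈ l, x.2 = (minKeyT ⊤ l).val := by
  rcases minKeyT_val_eq ⊤ l with h | h
  · obtain ⟨a, ha⟩ := List.exists_mem_of_ne_nil l hl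
    refine ⟨a, ha, le_antisymm (by rw [h]; exact le_top) ((minKeyT_val_le ⊤ l).2 a ha)⟩
  · exact h

lemma splitT_steps (p : ℝ≥0∞) (l : List (X × ℝ≥0∞)) : (splitT p l).steps = l.length + 1 := by
  induction l with
  | nil => rfl
  | cons a l ih =>
    simp only [splitT, tick, Timed.bind, ih, List.length_cons]
    split_ifs <;> simp [ret]

lemma splitT_perm (p : ℝ≥0∞) (l : List (X × ℝ≥0∞)) :
    ((splitT p l).val.1 ++ ((splitT p l).val.2.1 ++ (splitT p l).val.2.2)).Perm l := by
  induction l with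
  | nil => simp [splitT, tick, ret]
  | cons a l ih =>
    simp only [splitT, tick, Timed.bind]
    split_ifs
    · simpa [ret] using ih
    · simp only [ret]
      rw [← List.append_assoc]
      refine List.perm_middle.trans ?_
      rw [List.append_assoc]
      exact ih.cons a
    · simp only [ret]
      exact List.perm_middle.trans (ih.cons a)

lemma splitT_keys (p : ℝ≥0∞) (l : List (X × ℝ≥0∞)) :
    (∀ x ∈ (splitT p l).val.1, p < x.2) ∧ (∀ x ∈ (splitT p l).val.2.1, x.2 = p) ∧
      ∀ x ∈ (splitT p l).val.2.2, x.2 < p := by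
  induction l with
  | nil => simp [splitT, tick, ret]
  | cons a l ih =>
    obtain ⟨h1, h2, h3⟩ := ih
    simp only [splitT, tick, Timed.bind]
    split_ifs with h h'
    · simp only [ret, List.forall_mem_cons]
      exact ⟨⟨h, h1⟩, h2, h3⟩
    · simp only [ret, List.forall_mem_cons]
      exact ⟨h1, h2, h', h3⟩
    · simp only [ret, List.forall_mem_cons]
      exact ⟨h1, ⟨le_antisymm (not_lt.1 h) (not_lt.1 h'), h2⟩, h3⟩

lemma countP_ge_eq_splitT (p : ℝ≥0∞) (l : List (X × ℝ≥0∞)) :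
    l.countP (fun x => p ≤ x.2) = (splitT p l).val.1.length + (splitT p l).val.2.1.length := by
  obtain ⟨h1, h2, h3⟩ := splitT_keys p l
  rw [← (splitT_perm p l).countP_eq, List.countP_append, List.countP_append,
    List.countP_eq_length.2 fun x hx => by simpa using (h1 x hx).le,
    List.countP_eq_length.2 fun x hx => by simpa using (h2 x hx).ge,
    List.countP_eq_zero.2 fun x hx => by simpa using h3 x hx]
  omega

lemma countP_le_eq_splitT (p : ℝ≥0∞) (l : List (X × ℝ≥0∞)) :
    l.countP (fun x => x.2 ≤ p) = (splitT p l).val.2.1.length + (splitT p l).val.2.2.length := by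
  obtain ⟨h1, h2, h3⟩ := splitT_keys p l
  rw [← (splitT_perm p l).countP_eq, List.countP_append, List.countP_append,
    List.countP_eq_zero.2 fun x hx => by simpa using h1 x hx,
    List.countP_eq_length.2 fun x hx => by simpa using (h2 x hx).le,
    List.countP_eq_length.2 fun x hx => by simpa using (h3 x hx).le]
  omega

/-! ### Correctness of the selection -/

/-- `o` consists of `q` entries of `l` with the largest keys (of all entries if there are fewer). -/
def IsTop (q : ℕ) (l o : List (X × ℝ≥0∞)) : Prop :=
  o.length = min q l.length ∧
    ∃ rest, (o ++ rest).Perm l ∧ ∀ a ∈ o, ∀ b ∈ rest, b.2 ≤ a.2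

/-- The key at which `topT` splits a long list. -/
def pivot (f : ℕ) (l : List (X × ℝ≥0∞)) : ℝ≥0∞ :=
  (minKeyT ⊤ (topT f ((l.length / 5 + 1) / 2) (mediansT l).val).val).val

lemma topT_val_of_length_le {f q : ℕ} {l : List (X × ℝ≥0∞)} (h : l.length ≤ 100) :
    (topT (f + 1) q l).val = (sortT l).val.take q := by
  simp only [topT, tick, Timed.bind, lenT_val, if_pos h, takeT_val]

lemma topT_steps_of_length_le {f q : ℕ} {l : List (X × ℝ≥0∞)} (h : l.length ≤ 100) :
    (topT (f + 1) q l).steps ≤ 104 * l.length + 104 := by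
  have h1 := sortT_steps_le l
  have h2 := takeT_steps_le q (sortT l).val
  rw [(sortT_perm l).length_eq] at h2
  simp only [topT, tick, Timed.bind, lenT_val, lenT_steps, if_pos h]
  nlinarith

lemma topT_val_of_lt_length {f q : ℕ} {l : List (X × ℝ≥0∞)} (h : 100 < l.length) :
    (topT (f + 1) q l).val =
      if q ≤ (splitT (pivot f l) l).val.1.length then (topT f q (splitT (pivot f l) l).val.1).val
      else if q ≤ (splitT (pivot f l) l).val.1.length + (splitT (pivot f l) l).val.2.1.length then
        (splitT (pivot f l) l).val.1 ++ (splitT (pivot f l) l).val.2.1.take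
          (q - (splitT (pivot f l) l).val.1.length)
      else (splitT (pivot f l) l).val.1 ++ ((splitT (pivot f l) l).val.2.1 ++
        (topT f (q - (splitT (pivot f l) l).val.1.length - (splitT (pivot f l) l).val.2.1.length)
          (splitT (pivot f l) l).val.2.2).val) := by
  simp only [topT, tick, Timed.bind, lenT_val, if_neg (not_le.2 h), mediansT_length]
  rw [← pivot]
  split_ifs <;> simp only [appT_val, takeT_val]

lemma topT_steps_of_lt_length {f q : ℕ} {l : List (X × ℝ≥0∞)} (h : 100 < l.length) :
    (topT (f + 1) q l).steps =
      l.length + 1 + (mediansT l).steps + (l.length / 5 + 1) +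
      (topT f ((l.length / 5 + 1) / 2) (mediansT l).val).steps +
      ((topT f ((l.length / 5 + 1) / 2) (mediansT l).val).val.length + 1) + (l.length + 1) +
      ((splitT (pivot f l) l).val.1.length + 1) + ((splitT (pivot f l) l).val.2.1.length + 1) + 1 +
      if q ≤ (splitT (pivot f l) l).val.1.length then
        (topT f q (splitT (pivot f l) l).val.1).steps
      else if q ≤ (splitT (pivot f l) l).val.1.length + (splitT (pivot f l) l).val.2.1.length then
        (takeT (q - (splitT (pivot f l) l).val.1.length) (splitT (pivot f l) l).val.2.1).steps +
          ((splitT (pivot f l) l).val.1.length + 1)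
      else (topT f (q - (splitT (pivot f l) l).val.1.length -
            (splitT (pivot f l) l).val.2.1.length) (splitT (pivot f l) l).val.2.2).steps +
          ((splitT (pivot f l) l).val.2.1.length + 1) +
          ((splitT (pivot f l) l).val.1.length + 1) := by
  simp only [topT, tick, Timed.bind, lenT_val, lenT_steps, if_neg (not_le.2 h), mediansT_length,
    minKeyT_steps]
  rw [← pivot]
  split_ifs <;> simp only [appT_steps, splitT_steps] <;> omega

lemma exists_mem_key_eq_pivot {f : ℕ} {l : List (X × ℝ≥0∞)} (hl : 100 < l.length)
    (h : IsTop ((l.length / 5 + 1) / 2) (mediansT l).val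
      (topT f ((l.length / 5 + 1) / 2) (mediansT l).val).val) :
    ∃ x ∈ l, x.2 = pivot f l := by
  obtain ⟨hlen, rest, hperm, -⟩ := h
  obtain ⟨x, hx, hp⟩ := exists_mem_key_eq_minKeyT (l := (topT f ((l.length / 5 + 1) / 2)
    (mediansT l).val).val) (by
      intro h0
      rw [h0, mediansT_length, List.length_nil] at hlen
      omega)
  exact ⟨x, mem_of_mem_mediansT l x (hperm.mem_iff.1 (List.mem_append_left _ hx)), hp⟩

lemma splitT_length (p : ℝ≥0∞) (l : List (X × ℝ≥0∞)) :
    (splitT p l).val.1.length + (splitT p l).val.2.1.length + (splitT p l).val.2.2.length =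
      l.length := by
  rw [← (splitT_perm p l).length_eq, List.length_append, List.length_append, add_assoc]

lemma splitT_equal_ne_nil {p : ℝ≥0∞} {l : List (X × ℝ≥0∞)} (h : ∃ x ∈ l, x.2 = p) :
    0 < (splitT p l).val.2.1.length := by
  obtain ⟨x, hx, rfl⟩ := h
  obtain ⟨h1, h2, h3⟩ := splitT_keys x.2 l
  rw [List.length_pos_iff_exists_mem]
  refine ⟨x, ?_⟩
  rcases List.mem_append.1 ((splitT_perm x.2 l).mem_iff.2 hx) with h | h
  · exact absurd (h1 x h) (lt_irrefl _)
  · rcases List.mem_append.1 h with h | h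
    · exact h
    · exact absurd (h3 x h) (lt_irrefl _)

/-- The pivot is the key of an actual entry, so the middle class of the split is nonempty and the
two outer ones are shorter than `l`; hence the depth `f` suffices. The three classes are ordered by
key, and the cut after `q` entries falls into one of them. -/
lemma topT_isTop (f : ℕ) : ∀ (q : ℕ) (l : List (X × ℝ≥0∞)), l.length ≤ f →
    IsTop q l (topT f q l).val := by
  induction f with
  | zero =>
    intro q l hl
    obtain rfl : l = [] := List.eq_nil_of_length_eq_zero (by omega)
    refine ⟨?_, [], ?_, ?_⟩ <;> simp [topT, tick, takeT_val]
  | succ f ih =>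
    intro q l hl
    by_cases hlen : l.length ≤ 100
    · rw [topT_val_of_length_le hlen]
      refine ⟨by rw [List.length_take, (sortT_perm l).length_eq], (sortT l).val.drop q, ?_, ?_⟩
      · rw [List.take_append_drop]
        exact sortT_perm l
      · have := sortT_pairwise l
        rw [← List.take_append_drop q (sortT l).val, List.pairwise_append] at this
        exact this.2.2
    · rw [not_le] at hlen
      have hM := ih ((l.length / 5 + 1) / 2) (mediansT l).val (by rw [mediansT_length]; omega)
      have hpos := splitT_equal_ne_nil (exists_mem_key_eq_pivot hlen hM)
      rw [topT_val_of_lt_length hlen]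
      have hsum := splitT_length (pivot f l) l
      have hperm := splitT_perm (pivot f l) l
      obtain ⟨h1, h2, h3⟩ := splitT_keys (pivot f l) l
      generalize pivot f l = p at *
      generalize (splitT p l).val.1 = s₁ at *
      generalize (splitT p l).val.2.1 = s₂ at *
      generalize (splitT p l).val.2.2 = s₃ at *
      split_ifs with hq hq'
      · obtain ⟨e1, rest, e2, e3⟩ := ih q s₁ (by omega)
        refine ⟨by rw [e1]; omega, rest ++ (s₂ ++ s₃), ?_, fun a ha b hb => ?_⟩
        · rw [← List.append_assoc]
          exact (e2.append_right _).trans hperm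
        · rcases List.mem_append.1 hb with hb | hb
          · exact e3 a ha b hb
          · have ha' := h1 a (e2.mem_iff.1 (List.mem_append_left _ ha))
            rcases List.mem_append.1 hb with hb | hb
            · exact (h2 b hb).trans_le ha'.le
            · exact ((h3 b hb).trans ha').le
      · refine ⟨by rw [List.length_append, List.length_take]; omega,
          s₂.drop (q - s₁.length) ++ s₃, ?_, fun a ha b hb => ?_⟩
        · rw [List.append_assoc, ← List.append_assoc (List.take _ _), List.take_append_drop]
          exact hperm
        · have ha' : p ≤ a.2 := by
            rcases List.mem_append.1 ha with ha | ha
            · exact (h1 a ha).le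
            · exact (h2 a (List.mem_of_mem_take ha)).ge
          refine le_trans ?_ ha'
          rcases List.mem_append.1 hb with hb | hb
          · exact (h2 b (List.mem_of_mem_drop hb)).le
          · exact (h3 b hb).le
      · obtain ⟨e1, rest, e2, e3⟩ := ih (q - s₁.length - s₂.length) s₃ (by omega)
        refine ⟨by rw [List.length_append, List.length_append, e1]; omega, rest, ?_,
          fun a ha b hb => ?_⟩
        · rw [List.append_assoc, List.append_assoc]
          exact ((e2.append_left _).append_left _).trans hperm
        · have hb' := (h3 b (e2.mem_iff.1 (List.mem_append_right _ hb))).le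
          rcases List.mem_append.1 ha with ha | ha
          · exact hb'.trans (h1 a ha).le
          · rcases List.mem_append.1 ha with ha | ha
            · exact hb'.trans (h2 a ha).ge
            · exact e3 a ha b hb

/-! ### Linear running time of the selection -/

/-- The pivot is the least key in the upper half of the representatives: those selected have keys at
least the pivot, the remaining ones at most. The two counting bounds carry this over to `l`. -/
lemma pivot_rank {f : ℕ} {l : List (X × ℝ≥0∞)}
    (h : IsTop ((l.length / 5 + 1) / 2) (mediansT l).val
      (topT f ((l.length / 5 + 1) / 2) (mediansT l).val).val) (hl : 100 < l.length) :
    2 * ((l.length / 5 + 1) / 2) ≤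
      (splitT (pivot f l) l).val.1.length + (splitT (pivot f l) l).val.2.1.length ∧
    (splitT (pivot f l) l).val.1.length + 4 * (l.length / 5 - (l.length / 5 + 1) / 2) ≤
      l.length := by
  have hmin := (minKeyT_val_le ⊤ (topT f ((l.length / 5 + 1) / 2) (mediansT l).val).val).2
  rw [← pivot] at hmin
  obtain ⟨x, hx, hp⟩ : ∃ x ∈ (topT f ((l.length / 5 + 1) / 2) (mediansT l).val).val,
      x.2 = pivot f l := exists_mem_key_eq_minKeyT (by
    intro h0
    have := h.1
    rw [h0, mediansT_length, List.length_nil] at this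
    omega)
  obtain ⟨hlen, rest, hperm, hle⟩ := h
  have hlen2 := hperm.length_eq
  rw [List.length_append] at hlen2
  rw [mediansT_length] at hlen hlen2
  have h1 := two_mul_countP_mediansT_le (pivot f l) l
  have h2 := four_mul_countP_mediansT_le (pivot f l) l
  rw [countP_ge_eq_splitT _ l, ← hperm.countP_eq, List.countP_append,
    List.countP_eq_length.2 fun x hx => by simpa using hmin x hx] at h1
  rw [countP_le_eq_splitT _ l, ← hperm.countP_eq, List.countP_append,
    List.countP_eq_length (l := rest).2 fun b hb => by
      simpa using (hle x hx b hb).trans hp.le] at h2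
  have h3 := splitT_length (pivot f l) l
  omega

/-- The part below the pivot may have about `4 / 5` of the entries, which together with the `1 / 5`
for the representatives is too much for an induction on the length alone. The term in `q` saves it:
recursing below the pivot also lowers `q` by the number of entries discarded, at least about a fifth
of the length. The part above the pivot has at most about `3 / 5` of the entries. -/
lemma topT_steps_le (f : ℕ) : ∀ (q : ℕ) (l : List (X × ℝ≥0∞)), l.length ≤ f →
    (topT f q l).steps ≤ 300 * l.length + 210 * q + 104 := by
  induction f with
  | zero =>
    intro q l hl
    have := takeT_steps_le q l
    simp only [topT, tick]
    omega
  | succ f ih =>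
    intro q l hl
    by_cases hlen : l.length ≤ 100
    · exact (topT_steps_of_length_le hlen).trans (by omega)
    · rw [not_le] at hlen
      have hM := topT_isTop f ((l.length / 5 + 1) / 2) (mediansT l).val
        (by rw [mediansT_length]; omega)
      have hMs := ih ((l.length / 5 + 1) / 2) (mediansT l).val (by rw [mediansT_length]; omega)
      have hpos := splitT_equal_ne_nil (exists_mem_key_eq_pivot hlen hM)
      obtain ⟨hr1, hr2⟩ := pivot_rank hM hlen
      have hT := hM.1
      rw [mediansT_length] at hT hMs
      have hmed := mediansT_steps_le l
      have hsum := splitT_length (pivot f l) l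
      rw [topT_steps_of_lt_length hlen]
      generalize pivot f l = p at *
      generalize (splitT p l).val.1 = s₁ at *
      generalize (splitT p l).val.2.1 = s₂ at *
      generalize (splitT p l).val.2.2 = s₃ at *
      split_ifs with hq hq'
      · have := ih q s₁ (by omega)
        omega
      · have := takeT_steps_le (q - s₁.length) s₂
        omega
      · have := ih (q - s₁.length - s₂.length) s₃ (by omega)
        omega

end Selection

/-! ### The timed algorithm computes the greedy sampling algorithm -/

section RandomizedSequencing

variable {α : Type u} {β : Type v}

lemma map_val_bindR (x : PMF (Timed α)) (f : α → PMF (Timed β)) :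
    (bindR x f).map Timed.val = (x.map Timed.val).bind fun a => (f a).map Timed.val := by
  rw [bindR, PMF.map_bind, PMF.bind_map]
  congr 1
  funext a
  rw [PMF.map_comp]
  rfl

lemma map_val_bindR_pure (x : Timed α) (f : α → PMF (Timed β)) :
    (bindR (PMF.pure x) f).map Timed.val = (f x.val).map Timed.val := by
  rw [map_val_bindR, PMF.pure_map, PMF.pure_bind]

lemma mem_support_bindR {x : PMF (Timed α)} {f : α → PMF (Timed β)} {r : Timed β}
    (h : r ∈ (bindR x f).support) :
    ∃ a ∈ x.support, ∃ b ∈ (f a.val).support, r = ⟨b.val, a.steps + b.steps⟩ := by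
  simp only [bindR, PMF.mem_support_bind_iff, PMF.mem_support_map_iff] at h
  obtain ⟨a, ha, b, hb, rfl⟩ := h
  exact ⟨a, ha, b, hb, rfl⟩

lemma mem_support_bindR_pure {x : Timed α} {f : α → PMF (Timed β)} {r : Timed β}
    (h : r ∈ (bindR (PMF.pure x) f).support) :
    ∃ b ∈ (f x.val).support, r = ⟨b.val, x.steps + b.steps⟩ := by
  obtain ⟨a, ha, b, hb, rfl⟩ := mem_support_bindR h
  rw [PMF.support_pure, Set.mem_singleton_iff] at ha
  subst ha
  exact ⟨b, hb, rfl⟩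

end RandomizedSequencing

/-! ### Uniform draws from a list -/

section Drawing

variable {X : Type u}

/-- Without repetitions each vertex has exactly one index, so a uniform index yields a uniform
vertex. -/
lemma map_getT_uniform [DecidableEq X] (a : X) (l : List X) (h : (a :: l).Nodup)
    (hne : (a :: l).toFinset.Nonempty) :
    ((PMF.uniformOfFintype (Fin (l.length + 1))).map fun i : Fin (l.length + 1) =>
      (getT a l i).val) = PMF.uniformOfFinset (a :: l).toFinset hne := by
  have hval : ∀ i : Fin (l.length + 1), (getT a l i).val = (a :: l)[(i : ℕ)]'i.isLt :=
    fun i => getT_val a l i i.isLt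
  ext x
  rw [PMF.map_apply, PMF.uniformOfFinset_apply, List.toFinset_card_of_nodup h]
  split_ifs with hx
  · rw [List.mem_toFinset, List.mem_iff_getElem] at hx
    obtain ⟨i, hi, rfl⟩ := hx
    rw [tsum_eq_single (⟨i, by simpa using hi⟩ : Fin (l.length + 1))]
    · rw [hval, if_pos rfl, PMF.uniformOfFintype_apply, Fintype.card_fin, List.length_cons]
    · intro j hj
      rw [if_neg]
      intro he
      rw [hval, h.getElem_inj_iff] at he
      exact hj (Fin.ext he.symm)
  · rw [ENNReal.tsum_eq_zero]
    intro i
    rw [if_neg]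
    rintro rfl
    exact hx (by rw [List.mem_toFinset, hval]; exact List.getElem_mem _)

lemma map_val_sampleT [DecidableEq X] {V : List X} (hV : V.Nodup) (s : ℕ) :
    (sampleT V s).map Timed.val = sample V.toFinset s := by
  induction s with
  | zero => simp [sampleT, sample, PMF.pure_map, tick, ret]
  | succ s ih => cases V with
    | nil => simp [sampleT, sample, PMF.pure_map, tick, ret]
    | cons a l =>
      have hne : (a :: l).toFinset.Nonempty := ⟨a, by simp⟩
      rw [sampleT, sample, dif_pos hne, map_val_bindR_pure, map_val_bindR, PMF.map_comp]
      rw [← map_getT_uniform a l hV hne]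
      congr 1
      · change PMF.map _ (PMF.map (fun i : Fin (l.length + 1) => (i : ℕ)) _) = _
        rw [PMF.map_comp]
        rfl
      funext x
      rw [map_val_bindR, ih, PMF.map]
      congr 1
      funext r
      simp [PMF.pure_map, ret]

lemma sampleT_support {V : List X} {s : ℕ} : ∀ {r : Timed (List X)}, r ∈ (sampleT V s).support →
    r.val.length ≤ s ∧ r.steps ≤ s * (2 * V.length + 3) + 1 := by
  induction s with
  | zero =>
    intro r hr
    simp only [sampleT, PMF.support_pure, Set.mem_singleton_iff] at hr
    subst hr
    simp [tick, ret]
  | succ s ih =>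
    intro r hr
    cases V with
    | nil =>
      simp only [sampleT, PMF.support_pure, Set.mem_singleton_iff] at hr
      subst hr
      simp [tick, ret]
    | cons a l =>
      rw [sampleT] at hr
      obtain ⟨b, hb, rfl⟩ := mem_support_bindR_pure hr
      obtain ⟨x, hx, c, hc, rfl⟩ := mem_support_bindR hb
      obtain ⟨d, hd, e, he, rfl⟩ := mem_support_bindR hc
      rw [PMF.support_pure, Set.mem_singleton_iff] at he
      subst he
      rw [PMF.mem_support_map_iff] at hx
      obtain ⟨i, -, rfl⟩ := hx
      have h1 := getT_steps_le a l i
      obtain ⟨h2, h3⟩ := ih hd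
      have h4 := lenT_steps (a :: l)
      simp only [ret, tick, List.length_cons] at *
      refine ⟨by omega, ?_⟩
      rw [Nat.succ_mul]
      omega

end Drawing

/-! ### Distance tables -/

section Tables

variable {X : Type u}

lemma initT_val (l : List X) : (initT l).val = l.map fun p => (p, ⊤) := by
  induction l with
  | nil => rfl
  | cons a l ih => simp [initT, tick, Timed.bind, ret, ih]

lemma initT_steps (l : List X) : (initT l).steps = l.length + 1 := by
  induction l with
  | nil => rfl
  | cons a l ih => simp [initT, tick, Timed.bind, ret, ih]

lemma verticesT_val (l : List (X × ℝ≥0∞)) : (verticesT l).val = l.map Prod.fst := by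
  induction l with
  | nil => rfl
  | cons a l ih => simp [verticesT, tick, Timed.bind, ret, ih]

lemma verticesT_steps (l : List (X × ℝ≥0∞)) : (verticesT l).steps = l.length + 1 := by
  induction l with
  | nil => rfl
  | cons a l ih => simp [verticesT, tick, Timed.bind, ret, ih]

variable [MetricSpace X]

lemma updateT_val (c : X) (l : List (X × ℝ≥0∞)) :
    (updateT c l).val = l.map fun a => (a.1, min a.2 (edist a.1 c)) := by
  induction l with
  | nil => rfl
  | cons a l ih => simp [updateT, tick, Timed.bind, ret, ih]

lemma updateT_steps (c : X) (l : List (X × ℝ≥0∞)) : (updateT c l).steps = l.length + 1 := by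
  induction l with
  | nil => rfl
  | cons a l ih => simp [updateT, tick, Timed.bind, ret, ih]

lemma updatesT_length (a : List X) (D : List (X × ℝ≥0∞)) :
    (updatesT a D).val.length = D.length := by
  induction a generalizing D with
  | nil => rfl
  | cons c a ih => simp [updatesT, tick, Timed.bind, ih, updateT_val]

lemma updatesT_steps (a : List X) (D : List (X × ℝ≥0∞)) :
    (updatesT a D).steps = a.length * (D.length + 2) + 1 := by
  induction a generalizing D with
  | nil => simp [updatesT, tick, ret]
  | cons c a ih =>
    simp only [updatesT, tick, Timed.bind, ih, updateT_val, updateT_steps, List.length_map,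
      List.length_cons]
    ring

/-- The vertices with their distances to `E`. -/
def distTable (vs : List X) (E : Finset X) : List (X × ℝ≥0∞) := vs.map fun x => (x, distTo E x)

lemma distTable_length (vs : List X) (E : Finset X) : (distTable vs E).length = vs.length :=
  List.length_map _

/-- The initial entry `⊤` is the infimum over no centers. -/
lemma initT_val_eq_distTable (vs : List X) : (initT vs).val = distTable vs ∅ := by
  simp [initT_val, distTable, distTo]

variable [DecidableEq X]

lemma updateT_distTable (vs : List X) (E : Finset X) (c : X) :
    (updateT c (distTable vs E)).val = distTable vs (insert c E) := by
  simp only [updateT_val, distTable, List.map_map]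
  congr 1
  funext x
  simp [distTo, Finset.inf_insert, min_comm]

lemma updatesT_distTable (vs a : List X) (E : Finset X) :
    (updatesT a (distTable vs E)).val = distTable vs (a.toFinset ∪ E) := by
  induction a generalizing E with
  | nil => simp [updatesT, tick, ret]
  | cons c a ih =>
    simp only [updatesT, tick, Timed.bind, updateT_distTable, ih]
    congr 1
    ext x
    simp only [Finset.mem_union, Finset.mem_insert, List.mem_toFinset, List.mem_cons]
    tauto

end Tables

/-! ### Equality of the output laws -/

section Correctness

lemma length_eq_card {X : Type u} [Fintype X] {vs : List X} (hvs : vs.Nodup)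
    (hmem : ∀ x, x ∈ vs) : vs.length = Fintype.card X := by
  classical
  rw [← List.toFinset_card_of_nodup hvs, ← Finset.card_univ]
  congr 1
  ext x
  simp [hmem x]

variable {X : Type u} [MetricSpace X] [DecidableEq X]

/-- The farthest vertices which the timed algorithm selects. -/
def selected (vs : List X) (q : ℕ) (l : List X) : List X :=
  (topT vs.length q (distTable vs l.toFinset)).val.map Prod.fst

lemma selected_nodup {vs : List X} (hvs : vs.Nodup) (q : ℕ) (l : List X) :
    (selected vs q l).Nodup := by
  obtain ⟨-, rest, hperm, -⟩ := topT_isTop vs.length q (distTable vs l.toFinset)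
    (distTable_length vs _).le
  have h : (((topT vs.length q (distTable vs l.toFinset)).val ++ rest).map Prod.fst).Nodup := by
    refine (hperm.map Prod.fst).nodup_iff.2 ?_
    simpa [distTable, List.map_map, Function.comp_def] using hvs
  rw [List.map_append] at h
  exact (List.nodup_append.1 h).1

lemma isFarthest_selected {vs : List X} (hvs : vs.Nodup) (hmem : ∀ x, x ∈ vs) {q : ℕ}
    (hq : q ≤ vs.length) (l : List X) :
    IsFarthest q l.toFinset (selected vs q l).toFinset := by
  have hnd := selected_nodup hvs q l
  obtain ⟨hlen, rest, hperm, hle⟩ := topT_isTop vs.length q (distTable vs l.toFinset)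
    (distTable_length vs _).le
  have hkey : ∀ a ∈ (topT vs.length q (distTable vs l.toFinset)).val ++ rest,
      a.2 = distTo l.toFinset a.1 := by
    intro a ha
    rw [hperm.mem_iff, distTable, List.mem_map] at ha
    obtain ⟨x, -, rfl⟩ := ha
    rfl
  refine ⟨?_, fun x hx y hy => ?_⟩
  · rw [List.toFinset_card_of_nodup hnd, selected, List.length_map, hlen, distTable_length,
      min_eq_left hq]
  · rw [List.mem_toFinset, selected, List.mem_map] at hx hy
    obtain ⟨a, ha, rfl⟩ := hx
    have hy' : (y, distTo l.toFinset y) ∈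
        (topT vs.length q (distTable vs l.toFinset)).val ++ rest :=
      hperm.mem_iff.2 (List.mem_map_of_mem (hmem y))
    rcases List.mem_append.1 hy' with h | h
    · exact absurd ⟨_, h, rfl⟩ hy
    · rw [← hkey a (List.mem_append_left _ ha)]
      exact hle a ha _ h

/-- The invariant is that the table equals `distTable vs l.toFinset`. It is thus a function of `l`,
and the selection made by the program is a rule depending on past choices only. -/
lemma map_val_roundsT {vs : List X} (hvs : vs.Nodup) (q s m : ℕ) : ∀ l : List X,
    (roundsT vs.length q s m (distTable vs l.toFinset) l).map Timed.val =
      rounds (fun l => (selected vs q l).toFinset) s m l := by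
  induction m with
  | zero =>
    intro l
    simp [roundsT, rounds, PMF.pure_map, tick, ret]
  | succ m ih =>
    intro l
    rw [roundsT, rounds, map_val_bindR_pure, map_val_bindR_pure, map_val_bindR]
    simp only [tick, verticesT_val]
    rw [← selected, map_val_sampleT (selected_nodup hvs q l)]
    congr 1
    funext a
    rw [map_val_bindR_pure, map_val_bindR_pure, appT_val, updatesT_distTable,
      ← List.toFinset_append, ih]

lemma map_val_greedyT [Fintype X] {vs : List X} (hvs : vs.Nodup) (hmem : ∀ x, x ∈ vs) (k z : ℕ)
    (ε η : ℝ) :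
    (greedyT vs k z ε η).map Timed.val =
      greedy (fun l => (selected vs (farSize (Fintype.card X) z ε) l).toFinset) k z ε η := by
  have huniv : vs.toFinset = Finset.univ := by
    ext x
    simp [hmem x]
  have hcard := length_eq_card hvs hmem
  simp only [greedyT, map_val_bindR_pure]
  rw [map_val_bindR, map_val_sampleT hvs, huniv, greedy]
  simp only [tick, ret, lenT_val, initT_val_eq_distTable, map_val_bindR_pure, updatesT_distTable,
    Finset.union_empty]
  rw [hcard]
  congr 1
  funext l
  rw [← hcard]
  exact map_val_roundsT hvs _ _ _ l

end Correctness

/-! ### Running time -/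

section RunningTime

variable {X : Type u} [MetricSpace X]

/-- As `q ≤ n`, a selection takes at most `510 * n + 104` steps; each of the `s` draws adds about `3
* n` for picking an entry and updating the table. The constant 700 is generous. -/
lemma roundsT_steps_le {n q s : ℕ} (hq : q ≤ n) (hn : 0 < n) (m : ℕ) :
    ∀ {D : List (X × ℝ≥0∞)} {l : List X} {r : Timed (List X)}, D.length = n →
      r ∈ (roundsT n q s m D l).support → r.steps ≤ m * (700 * (s + 1) * n) + 1 := by
  induction m with
  | zero =>
    intro D l r _ hr
    simp only [roundsT, PMF.support_pure, Set.mem_singleton_iff] at hr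
    subst hr
    simp [tick, ret]
  | succ m ih =>
    intro D l r hD hr
    rw [roundsT] at hr
    obtain ⟨b, hb, rfl⟩ := mem_support_bindR_pure hr
    obtain ⟨c, hc, rfl⟩ := mem_support_bindR_pure hb
    obtain ⟨a, ha, d, hd, rfl⟩ := mem_support_bindR hc
    obtain ⟨e, he, rfl⟩ := mem_support_bindR_pure hd
    obtain ⟨f, hf, rfl⟩ := mem_support_bindR_pure he
    have h1 := topT_steps_le n q D hD.le
    have h2 := (topT_isTop n q D hD.le).1
    obtain ⟨h3, h4⟩ := sampleT_support ha
    have h5 := ih (by rw [updatesT_length]; exact hD) hf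
    rw [verticesT_val, List.length_map] at h4
    simp only [tick] at h4
    simp only [tick, verticesT_steps, updatesT_steps, appT_steps, hD]
    have h6 : (topT n q D).val.length ≤ n := by rw [h2]; omega
    have h7 : s * (2 * (topT n q D).val.length + 3) ≤ s * (2 * n + 3) := by gcongr
    have h8 : a.val.length * (n + 2) ≤ s * (n + 2) := by gcongr
    have h9 : s ≤ s * n := Nat.le_mul_of_pos_right s hn
    rw [Nat.succ_mul]
    have h10 : 700 * (s + 1) * n = 700 * (s * n) + 700 * n := by ring
    have h11 : s * (2 * n + 3) = 2 * (s * n) + 3 * s := by ring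
    have h12 : s * (n + 2) = s * n + 2 * s := by ring
    omega

lemma farSize_le (n z : ℕ) (ε : ℝ) : farSize n z ε ≤ n := min_le_left _ _

lemma greedyT_steps_le {vs : List X} (hvs : 0 < vs.length) {k z : ℕ} {ε η : ℝ}
    {r : Timed (List X)} (hr : r ∈ (greedyT vs k z ε η).support) :
    r.steps ≤ 700 * ((numRounds k η - 1) * (roundSize ε η + 1) + firstSize vs.length z η + 1) *
      vs.length := by
  rw [greedyT] at hr
  obtain ⟨r₁, hr₁, rfl⟩ := mem_support_bindR_pure hr
  obtain ⟨r₂, hr₂, rfl⟩ := mem_support_bindR_pure hr₁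
  obtain ⟨r₃, hr₃, rfl⟩ := mem_support_bindR_pure hr₂
  obtain ⟨r₄, hr₄, rfl⟩ := mem_support_bindR_pure hr₃
  obtain ⟨r₅, hr₅, rfl⟩ := mem_support_bindR_pure hr₄
  obtain ⟨r₆, hr₆, rfl⟩ := mem_support_bindR_pure hr₅
  obtain ⟨a, ha, r₇, hr₇, rfl⟩ := mem_support_bindR hr₆
  obtain ⟨r₈, hr₈, rfl⟩ := mem_support_bindR_pure hr₇
  clear hr hr₁ hr₂ hr₃ hr₄ hr₅ hr₆ hr₇
  simp only [tick, ret, lenT_val] at ha hr₈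
  have hD : (updatesT a.val (initT vs).val).val.length = vs.length := by
    rw [updatesT_length, initT_val, List.length_map]
  have h1 := roundsT_steps_le (farSize_le _ _ _) hvs _ hD hr₈
  obtain ⟨h2, h3⟩ := sampleT_support ha
  simp only [tick, ret, lenT_steps, initT_steps, updatesT_steps, initT_val, List.length_map]
  generalize vs.length = n at *
  generalize firstSize n z η = s₁ at *
  generalize roundSize ε η = s at *
  generalize numRounds k η - 1 = t at *
  have h4 : a.val.length * (n + 2) ≤ s₁ * (n + 2) := by gcongr
  have h5 : s₁ ≤ s₁ * n := Nat.le_mul_of_pos_right s₁ hvs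
  have h6 : 700 * (t * (s + 1) + s₁ + 1) * n =
    t * (700 * (s + 1) * n) + 700 * (s₁ * n) + 700 * n := by ring
  have h7 : s₁ * (2 * n + 3) = 2 * (s₁ * n) + 3 * s₁ := by ring
  have h8 : s₁ * (n + 2) = s₁ * n + 2 * s₁ := by ring
  omega

end RunningTime

end KCenter

end

/-! ### The main theorem -/

theorem theorem1 (η : ℝ) (hη₀ : 0 < η) (hη₁ : η < 1) :
    -- success probability, for every way of selecting the farthest vertices
    (∀ (X : Type u) [Fintype X] [DecidableEq X] [MetricSpace X] (k z : ℕ) (ε : ℝ)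
        (Q : List X → Finset X),
      0 < k → 0 < z → z < Fintype.card X → 0 < ε → KCenter.IsFarthestRule z ε Q →
      ENNReal.ofReal ((1 - η) * (1 - Real.exp (-((1 - η) / 4)))) ≤
        (KCenter.greedy Q k z ε η).toOuterMeasure
          {l | KCenter.phi z ε l.toFinset ≤ 2 * KCenter.rOpt X k z}) ∧
    -- number of centers and running time, with a constant that depends only on `η` and on a bound
    -- `B` for `1 / (1 - γ)`, where `γ = z / n`
    (∀ B : ℝ, ∃ C : ℝ, 0 < C ∧
      ∀ (X : Type u) [Fintype X] [DecidableEq X] [MetricSpace X] (k z : ℕ) (ε : ℝ),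
        0 < k → 0 < z → z < Fintype.card X → 0 < ε →
        1 / (1 - (z : ℝ) / Fintype.card X) ≤ B →
        (∀ Q : List X → Finset X, KCenter.IsFarthestRule z ε Q →
          (∀ l ∈ (KCenter.greedy Q k z ε η).support,
            (l.toFinset.card : ℝ) ≤ C * (1 + 1 / ε) * k) ∧
          ENNReal.ofReal ((1 - η) * (1 - Real.exp (-((1 - η) / 4)))) ≤
            (KCenter.greedy Q k z ε η).toOuterMeasure
              {l | KCenter.IsBicriteriaApprox k z ε 2 (C * (1 + 1 / ε)) l.toFinset}) ∧
        (∀ vs : List X, vs.Nodup → (∀ x, x ∈ vs) →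
          (∃ Q : List X → Finset X, KCenter.IsFarthestRule z ε Q ∧
            (KCenter.greedyT vs k z ε η).map KCenter.Timed.val = KCenter.greedy Q k z ε η) ∧
          ∀ r ∈ (KCenter.greedyT vs k z ε η).support,
            (r.steps : ℝ) ≤ C * (1 + 1 / ε) * k * Fintype.card X)) := by
  refine ⟨fun X _ _ _ k z ε Q hk hz hzn hε hQ =>
    KCenter.success_probability hη₀ hη₁ hk hz hzn hε hQ, fun B => ?_⟩
  obtain ⟨C, hC, hbound⟩ := KCenter.draws_le hη₀ hη₁ B
  -- The factor 700 is needed for the running time only; it gives one constant for both bounds.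
  refine ⟨700 * C, by positivity, fun X _ _ _ k z ε hk hz hzn hε hB => ⟨fun Q hQ => ?_,
    fun vs hvs hmem => ⟨⟨_, fun l => KCenter.isFarthest_selected hvs hmem ?_ l,
      KCenter.map_val_greedyT hvs hmem k z ε η⟩, fun r hr => ?_⟩⟩⟩
  · have hcard : ∀ l ∈ (KCenter.greedy Q k z ε η).support,
        (l.toFinset.card : ℝ) ≤ 700 * C * (1 + 1 / ε) * k := by
      intro l hl
      have h1 := (List.toFinset_card_le l).trans (KCenter.length_le_of_mem_support_greedy hl)
      have h2 := hbound (Fintype.card X) k z ε hk hε hB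
      have h3 : l.toFinset.card ≤ (KCenter.numRounds k η - 1) * (KCenter.roundSize ε η + 1) +
          KCenter.firstSize (Fintype.card X) z η + 1 := by
        rw [mul_add]
        omega
      have h4 : 0 ≤ C * (1 + 1 / ε) * k := by positivity
      calc (l.toFinset.card : ℝ) ≤ _ := Nat.cast_le.2 h3
        _ ≤ C * (1 + 1 / ε) * k := h2
        _ ≤ 700 * (C * (1 + 1 / ε) * k) := by linarith
        _ = 700 * C * (1 + 1 / ε) * k := by ring
    refine ⟨hcard, (KCenter.success_probability hη₀ hη₁ hk hz hzn hε hQ).trans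
      (PMF.toOuterMeasure_mono _ ?_)⟩
    rintro l ⟨hl, hsupp⟩
    exact ⟨hl, hcard l hsupp⟩
  · rw [KCenter.length_eq_card hvs hmem]
    exact KCenter.farSize_le _ _ _
  · have hlen := KCenter.length_eq_card hvs hmem
    have h1 := KCenter.greedyT_steps_le (by omega) hr
    rw [hlen] at h1
    have h2 := hbound (Fintype.card X) k z ε hk hε hB
    calc (r.steps : ℝ) ≤ _ := Nat.cast_le.2 h1
      _ = 700 * (((KCenter.numRounds k η - 1) * (KCenter.roundSize ε η + 1) +
          KCenter.firstSize (Fintype.card X) z η + 1 : ℕ) : ℝ) * Fintype.card X := by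
        rw [Nat.cast_mul, Nat.cast_mul, Nat.cast_ofNat]
      _ ≤ 700 * (C * (1 + 1 / ε) * k) * Fintype.card X := by gcongr
      _ = 700 * C * (1 + 1 / ε) * k * Fintype.card X := by ring
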